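/- Let $\mathfrak{l}$ be a finite-dimensional complex Lie algebra and let $\sigma:\mathfrak{l}\to\mathfrak{l}$ be an anti-holomorphic involution, that is, an automorphism of $\mathfrak{l}$ viewed as a real Lie algebra such that $\sigma(\alpha X)=\overline{\alpha}\,\sigma(X)$ for all $\alpha\in\mathbb{C}$, $X\in\mathfrak{l}$, and $\sigma^2=\mathrm{id}$. Then there exist an integer $m\ge 1$ and an injective homomorphism of complex Lie algebras $$\phi:\mathfrak{l}\longrightarrow\mathfrak{gl}_{2m}(\mathbb{C})$$ such that $$\phi(\sigma(X))=\overline{\phi(X)}\qquad\text{for all }X\in\mathfrak{l},$$ where $\overline{A}$ denotes the entrywise complex conjugate of a matrix $A$. -/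

import Mathlib

/- Matrix algebras carry the commutator bracket `⁅A, B⁆ = A * B - B * A`; this is Mathlib's
Lie ring structure on an associative ring, which Mathlib does not register globally. -/
attribute [local instance 100] LieRing.ofAssociativeRing

/-- An anti-holomorphic involution of a complex Lie algebra `L`: a conjugate-linear map
`σ : L → L` that preserves the Lie bracket and satisfies `σ ∘ σ = id`. Being conjugate-linear and
its own inverse, such a `σ` is in particular an automorphism of `L` viewed as a real Lie algebra. -/
structure IsAntiholomorphicInvolution {L : Type*} [LieRing L] [LieAlgebra ℂ L]
    (σ : L → L) : Prop where
  map_add : ∀ X Y : L, σ (X + Y) = σ X + σ Y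
  map_smul : ∀ (α : ℂ) (X : L), σ (α • X) = (starRingEnd ℂ) α • σ X
  map_lie : ∀ X Y : L, σ ⁅X, Y⁆ = ⁅σ X, σ Y⁆
  involutive : ∀ X : L, σ (σ X) = X

/-! The reality condition costs only a doubling of the dimension. Given a faithful complex
representation `f` of dimension `n`, the sum of `f` and its twist `X ↦ conj (f (σ X))` is complex
linear, and complex conjugation composed with `σ` swaps the two summands. A change of basis turns
that swap into plain entrywise conjugation. The real content is therefore Ado's theorem, proved here
over an algebraically closed field of characteristic zero.

Ado's theorem rests on Zassenhaus extension. Let `N` be a solvable ideal with a complementary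
subalgebra `H`, and let `N` act on `V` so that `[L, N]` acts nilpotently. Then `L` acts on `U(N)`,
with `N` acting by left multiplication and `H` by derivations. A power `J` of a suitable two-sided
ideal is stable, kills `V` and has finite codimension, so `U(N) / J` is a finite-dimensional
representation of `L` whose kernel meets `N` inside the kernel of `V`. Codimension-one extensions
give the solvable case. A Levi complement of the radical then gives an extension to all of `L`, and
adding the adjoint representation makes it faithful, since the centre lies in the radical. The Levi
complement comes from Cartan's criterion, Casimir operators and a Weyl-type argument. -/

/-! ### Powers of ideals of finite codimension -/

namespace Submodule

variable {K A : Type*} [Field K] [Ring A] [Algebra K A]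

lemma exists_fg_codisjoint_of_coFG {P : Submodule K A} (hP : P.CoFG) :
    ∃ C : Submodule K A, C.FG ∧ C ⊔ P = ⊤ := by
  obtain ⟨C, hC⟩ := P.exists_isCompl
  exact ⟨C, hP.fg_of_isCompl hC, by rw [sup_comm]; exact hC.sup_eq_top⟩

lemma coFG_of_fg_codisjoint {P C : Submodule K A} (hC : C.FG) (h : C ⊔ P = ⊤) : P.CoFG := by
  have : Module.Finite K C := .of_fg hC
  refine Module.Finite.of_surjective (P.mkQ ∘ₗ C.subtype) fun x ↦ ?_
  obtain ⟨a, rfl⟩ := P.mkQ_surjective x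
  have ha : a ∈ C ⊔ P := h ▸ mem_top
  obtain ⟨c, hc, p, hp, rfl⟩ := mem_sup.mp ha
  exact ⟨⟨c, hc⟩, by simpa using hp⟩

/-- In a finitely generated algebra, a two-sided ideal of finite codimension is finitely generated
as a left ideal. -/
lemma exists_fg_top_mul_eq_of_coFG {G : Submodule K A} (hG : G.FG)
    (hGtop : Algebra.adjoin K (G : Set A) = ⊤) {P : Submodule K A}
    (hl : ∀ a, ∀ p ∈ P, a * p ∈ P) (hP : P.CoFG) :
    ∃ F : Submodule K A, F.FG ∧ ⊤ * F = P := by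
  obtain ⟨C₀, hC₀, hC₀P⟩ := exists_fg_codisjoint_of_coFG hP
  set C := C₀ ⊔ 1 with hCdef
  have hC : C.FG := hC₀.sup (by rw [one_eq_span]; exact fg_span_singleton 1)
  have hCP : C ⊔ P = ⊤ := top_le_iff.mp (hC₀P ▸ sup_le_sup_right le_sup_left P)
  -- As in Schreier's lemma, `F` collects the errors made when a generator times a representative
  -- from `C` is rewritten modulo `P`.
  set F := (C ⊔ G * C) ⊓ P with hFdef
  have hF : F.FG := by
    have : Module.Finite K (C ⊔ G * C : Submodule K A) := .of_fg (hC.sup (hG.mul hC))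
    exact (Submodule.fg_top _).mp (Module.Finite.fg_top (M := F) (R := K))
  have hle : ⊤ * F ≤ P := by
    rw [mul_le]
    exact fun a _ p hp ↦ hl a p hp.2
  have hFle : F ≤ ⊤ * F := fun x hx ↦ by simpa using mul_mem_mul (mem_top (x := (1 : A))) hx
  -- The left side contains `1` and is stable under left multiplication by the generators.
  have htop : C ⊔ ⊤ * F = ⊤ := by
    have key : ∀ a : A, ∀ y ∈ C ⊔ ⊤ * F, a * y ∈ C ⊔ ⊤ * F := by
      intro a
      have ha : a ∈ Algebra.adjoin K (G : Set A) := hGtop ▸ Algebra.mem_top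
      induction ha using Algebra.adjoin_induction with
      | mem g hg =>
        intro y hy
        obtain ⟨c, hc, q, hq, rfl⟩ := mem_sup.mp hy
        rw [mul_add]
        refine add_mem ?_ (mem_sup_right ?_)
        · have : g * c ∈ C ⊔ P := hCP ▸ mem_top
          obtain ⟨c', hc', p, hp, hcp⟩ := mem_sup.mp this
          rw [← hcp]
          refine add_mem (mem_sup_left hc') (mem_sup_right (hFle ⟨?_, hp⟩))
          rw [show p = g * c - c' by rw [← hcp]; abel]
          exact sub_mem (mem_sup_right (mul_mem_mul hg hc)) (mem_sup_left hc')
        · have : g * q ∈ (⊤ * (⊤ * F) : Submodule K A) := mul_mem_mul mem_top hq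
          rw [← mul_assoc] at this
          exact mul_le_mul_left le_top F this
      | algebraMap r =>
        intro y hy
        rw [← Algebra.smul_def]
        exact smul_mem _ r hy
      | add x y _ _ hx hy => intro z hz; rw [add_mul]; exact add_mem (hx z hz) (hy z hz)
      | mul x y _ _ hx hy => intro z hz; rw [_root_.mul_assoc]; exact hx _ (hy z hz)
    refine eq_top_iff'.mpr fun a ↦ ?_
    simpa using key a 1 (mem_sup_left (mem_sup_right (one_le.mp le_rfl)))
  refine ⟨F, hF, le_antisymm hle fun p hp ↦ ?_⟩
  have : p ∈ C ⊔ ⊤ * F := by rw [htop]; exact mem_top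
  obtain ⟨c, hc, q, hq, rfl⟩ := mem_sup.mp this
  refine add_mem (hFle ⟨mem_sup_left hc, ?_⟩) hq
  simpa using sub_mem hp (hle hq)

/-- In a finitely generated algebra, powers of a two-sided ideal of finite codimension have finite
codimension. -/
lemma coFG_pow_succ {G : Submodule K A} (hG : G.FG)
    (hGtop : Algebra.adjoin K (G : Set A) = ⊤) {P : Submodule K A}
    (hl : ∀ a, ∀ p ∈ P, a * p ∈ P) (hP : P.CoFG) (k : ℕ) :
    (P ^ (k + 1)).CoFG := by
  obtain ⟨F, hF, hFP⟩ := exists_fg_top_mul_eq_of_coFG hG hGtop hl hP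
  induction k with
  | zero => simpa using hP
  | succ k ih =>
    obtain ⟨C, hC, hCP⟩ := exists_fg_codisjoint_of_coFG hP
    obtain ⟨D, hD, hDP⟩ := exists_fg_codisjoint_of_coFG ih
    refine coFG_of_fg_codisjoint (hC.sup (hD.mul hF)) ?_
    have h1 : F ≤ P := hFP ▸ fun x hx ↦ by simpa using mul_mem_mul (mem_top (x := (1 : A))) hx
    refine top_le_iff.mp ?_
    -- Since `P = A F` and `A = D + P ^ (k + 1)`, modulo `P ^ (k + 2)` the ideal `P` is spanned by
    -- the finite-dimensional `D * F`.
    calc ⊤ = C ⊔ P := hCP.symm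
      _ = C ⊔ (D ⊔ P ^ (k + 1)) * F := by rw [hDP, hFP]
      _ = C ⊔ (D * F ⊔ P ^ (k + 1) * F) := by rw [sup_mul]
      _ ≤ C ⊔ (D * F ⊔ P ^ (k + 1 + 1)) := by
        gcongr
        rw [pow_succ P (k + 1)]
        gcongr
      _ = C ⊔ D * F ⊔ P ^ (k + 1 + 1) := by rw [sup_assoc]

lemma mul_mem_pow_succ_right {P : Submodule K A} (hr : ∀ a, ∀ p ∈ P, p * a ∈ P) (k : ℕ) (a : A)
    {p : A} (hp : p ∈ P ^ (k + 1)) : p * a ∈ P ^ (k + 1) := by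
  rw [pow_succ] at hp ⊢
  induction hp using Submodule.mul_induction_on' with
  | mem_mul_mem m hm n hn => rw [_root_.mul_assoc]; exact mul_mem_mul hm (hr a n hn)
  | add x _ y _ hx hy => rw [add_mul]; exact add_mem hx hy

/-- A linear map satisfying the Leibniz rule and preserving an ideal preserves its powers. -/
lemma map_mem_pow_succ_of_leibniz {P : Submodule K A} {D : A →ₗ[K] A}
    (hD : ∀ a b, D (a * b) = D a * b + a * D b) (hDP : ∀ p ∈ P, D p ∈ P) (k : ℕ)
    {p : A} (hp : p ∈ P ^ (k + 1)) : D p ∈ P ^ (k + 1) := by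
  induction k generalizing p with
  | zero => simpa using hDP p (by simpa using hp)
  | succ k ih =>
    rw [pow_succ] at hp ⊢
    induction hp using Submodule.mul_induction_on' with
    | mem_mul_mem m hm n hn =>
      rw [hD]
      exact add_mem (mul_mem_mul (ih hm) hn) (mul_mem_mul hm (hDP n hn))
    | add x _ y _ hx hy => rw [map_add]; exact add_mem hx hy

end Submodule

/-! ### Generators and derivations of the enveloping algebra -/

namespace UniversalEnvelopingAlgebra

variable {K N : Type*} [CommRing K] [LieRing N] [LieAlgebra K N]

lemma adjoin_range_ι :
    Algebra.adjoin K (Set.range (ι K : N → UniversalEnvelopingAlgebra K N)) = ⊤ := by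
  set S := Algebra.adjoin K (Set.range (ι K : N → UniversalEnvelopingAlgebra K N)) with hS
  let f : N →ₗ⁅K⁆ S :=
    { toFun n := ⟨ι K n, Algebra.subset_adjoin ⟨n, rfl⟩⟩
      map_add' x y := by ext; simp only [map_add]; rfl
      map_smul' r x := by ext; simp only [map_smul]; rfl
      map_lie' {x y} := by ext; simp only [LieHom.map_lie]; rfl }
  have h : S.val.comp (lift K f) = AlgHom.id K _ := by
    ext n
    simp only [LieHom.comp_apply, AlgHom.coe_toLieHom, AlgHom.comp_apply, AlgHom.id_apply,
      lift_ι_apply]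
    rfl
  refine eq_top_iff.mpr fun a _ ↦ ?_
  have := DFunLike.congr_fun h a
  simp only [AlgHom.comp_apply, AlgHom.id_apply] at this
  rw [← this]
  exact (lift K f a).2

/-- Induction principle for the universal enveloping algebra. -/
@[elab_as_elim]
lemma induction {C : UniversalEnvelopingAlgebra K N → Prop}
    (ι_mem : ∀ n, C (ι K n)) (algebraMap_mem : ∀ r, C (algebraMap K _ r))
    (add : ∀ a b, C a → C b → C (a + b)) (mul : ∀ a b, C a → C b → C (a * b))
    (a : UniversalEnvelopingAlgebra K N) : C a := by
  have ha : a ∈ Algebra.adjoin K (Set.range (ι K : N → UniversalEnvelopingAlgebra K N)) :=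
    adjoin_range_ι (K := K) (N := N) ▸ Algebra.mem_top
  induction ha using Algebra.adjoin_induction with
  | mem x hx => obtain ⟨n, rfl⟩ := hx; exact ι_mem n
  | algebraMap r => exact algebraMap_mem r
  | add x y _ _ hx hy => exact add x y hx hy
  | mul x y _ _ hx hy => exact mul x y hx hy

/-- Two linear maps satisfying the Leibniz rule agree if they agree on the generators. -/
lemma eq_of_leibniz {D E : UniversalEnvelopingAlgebra K N →ₗ[K] UniversalEnvelopingAlgebra K N}
    (hD : ∀ a b, D (a * b) = D a * b + a * D b) (hE : ∀ a b, E (a * b) = E a * b + a * E b)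
    (h : ∀ n, D (ι K n) = E (ι K n)) : D = E := by
  have one_eq {D : UniversalEnvelopingAlgebra K N →ₗ[K] UniversalEnvelopingAlgebra K N}
      (hD : ∀ a b, D (a * b) = D a * b + a * D b) : D 1 = 0 := by
    simpa using hD 1 1
  ext a
  induction a using induction with
  | ι_mem n => exact h n
  | algebraMap_mem r =>
    rw [Algebra.algebraMap_eq_smul_one, map_smul, map_smul, one_eq hD, one_eq hE]
  | add a b ha hb => rw [map_add, map_add, ha, hb]
  | mul a b ha hb => rw [hD, hE, ha, hb]

-- The map `n ↦ n + ε d(n)` is a Lie homomorphism into the dual numbers over `U(N)` exactly because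
-- `d` is a derivation. Its extension to `U(N)` has the identity as first component, so its second
-- component obeys the Leibniz rule.
open TrivSqZeroExt in
lemma exists_leibniz (d : N →ₗ[K] N) (hd : ∀ x y, d ⁅x, y⁆ = ⁅d x, y⁆ + ⁅x, d y⁆) :
    ∃ D : UniversalEnvelopingAlgebra K N →ₗ[K] UniversalEnvelopingAlgebra K N,
      (∀ a b, D (a * b) = D a * b + a * D b) ∧ ∀ n, D (ι K n) = ι K (d n) := by
  let A := UniversalEnvelopingAlgebra K N
  let f : N →ₗ⁅K⁆ TrivSqZeroExt A A :=
    { toFun n := inl (ι K n) + inr (ι K (d n))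
      map_add' x y := by ext <;> simp only [map_add] <;> simp
      map_smul' r x := by ext <;> simp only [map_smul] <;> simp
      map_lie' {x y} := by
        ext
        · simp only [LieHom.map_lie, LieRing.of_associative_ring_bracket]; simp
        · simp only [LieHom.map_lie, LieRing.of_associative_ring_bracket, hd, map_add]
          simp only [snd_mul, snd_sub, snd_add, snd_inl, snd_inr, fst_add, fst_inl,
            fst_inr, zero_add, add_zero, smul_eq_mul, MulOpposite.smul_eq_mul_unop,
            MulOpposite.unop_op]
          abel }
  have hfst : (fstHom K A A).comp (lift K f) = AlgHom.id K A := by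
    ext n
    simp only [LieHom.comp_apply, AlgHom.coe_toLieHom, AlgHom.comp_apply, lift_ι_apply]
    simp [f]; rfl
  have hfst' (a : A) : (lift K f a).fst = a := DFunLike.congr_fun hfst a
  refine ⟨(sndHom A A).restrictScalars K ∘ₗ (lift K f).toLinearMap, fun a b ↦ ?_, fun n ↦ ?_⟩
  · simp [hfst', add_comm]
  · simp only [LinearMap.comp_apply, AlgHom.toLinearMap_apply, lift_ι_apply]
    simp [f]

end UniversalEnvelopingAlgebra

/-! ### Elements of a solvable algebra acting nilpotently -/

section

open Module LieModule UniversalEnvelopingAlgebra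

/-- `P` is a two-sided ideal of finite codimension in the universal enveloping algebra of `N` some
power of which annihilates `V`, and its degree one part consists of the elements of `N` acting
nilpotently on `V`, among which are all brackets. -/
structure IsNilradicalIdeal (K N V : Type*) [Field K] [LieRing N] [LieAlgebra K N]
    [AddCommGroup V] [Module K V] [LieRingModule N V] [LieModule K N V]
    (P : Submodule K (UniversalEnvelopingAlgebra K N)) : Prop where
  mul_mem_left : ∀ a, ∀ p ∈ P, a * p ∈ P
  mul_mem_right : ∀ a, ∀ p ∈ P, p * a ∈ P
  coFG : P.CoFG
  ι_mem_of_isNilpotent : ∀ n, IsNilpotent (toEnd K N V n) → ι K n ∈ P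
  ι_lie_mem : ∀ x y : N, ι K ⁅x, y⁆ ∈ P
  exists_pow : ∃ k, ∀ u ∈ P ^ (k + 1), lift K (toEnd K N V) u = 0

variable {K N : Type*} [Field K] [LieRing N] [LieAlgebra K N]

section

variable {V W : Type*} [AddCommGroup V] [Module K V] [LieRingModule N V] [LieModule K N V]
  [AddCommGroup W] [Module K W] [LieRingModule N W] [LieModule K N W]

lemma LieModuleHom.map_lift_toEnd (f : V →ₗ⁅K,N⁆ W) (u : UniversalEnvelopingAlgebra K N) (v : V) :
    f (lift K (toEnd K N V) u v) = lift K (toEnd K N W) u (f v) := by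
  induction u using UniversalEnvelopingAlgebra.induction generalizing v with
  | ι_mem n => rw [lift_ι_apply, lift_ι_apply]; simp
  | algebraMap_mem r => simp [Algebra.algebraMap_eq_smul_one]
  | add a b ha hb => simp [ha, hb]
  | mul a b ha hb => simp [ha, hb]

lemma lift_toEnd_apply_of_forall_lie_eq_smul {v : V} {χ : N →ₗ⁅K⁆ K}
    (h : ∀ n, ⁅n, v⁆ = χ n • v) (u : UniversalEnvelopingAlgebra K N) :
    lift K (toEnd K N V) u v = lift K χ u • v := by
  induction u using UniversalEnvelopingAlgebra.induction with
  | ι_mem n => rw [lift_ι_apply, lift_ι_apply]; simp [h]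
  | algebraMap_mem r => simp [Algebra.algebraMap_eq_smul_one]
  | add a b ha hb => simp [ha, hb, add_smul]
  | mul a b ha hb =>
    rw [map_mul, map_mul, Module.End.mul_apply, hb, map_smul, ha, smul_smul, mul_comm]

lemma IsNilradicalIdeal.isNilpotent {P : Submodule K (UniversalEnvelopingAlgebra K N)}
    (hP : IsNilradicalIdeal K N V P) {n : N} (hn : ι K n ∈ P) : IsNilpotent (toEnd K N V n) := by
  obtain ⟨k, hk⟩ := hP.exists_pow
  refine ⟨k + 1, ?_⟩
  rw [← lift_ι_apply K (toEnd K N V), ← map_pow]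
  exact hk _ (Submodule.pow_mem_pow _ hn _)

end

variable [IsAlgClosed K] [CharZero K]

/-- By Lie's theorem there is a common eigenvector `v`, of character `χ`. Inducting on the
dimension, intersect the ideal obtained for `V / K v` with the kernel of `χ` on `U(N)`. In effect,
`P` is the common kernel of the characters on the diagonal of a triangular form of `V`. -/
theorem exists_isNilradicalIdeal [LieAlgebra.IsSolvable N] (V : Type*) [AddCommGroup V]
    [Module K V] [LieRingModule N V] [LieModule K N V] [FiniteDimensional K V] :
    ∃ P, IsNilradicalIdeal K N V P := by
  induction h : finrank K V using Nat.strong_induction_on generalizing V with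
  | _ d ih =>
  rcases subsingleton_or_nontrivial V with hV | hV
  · exact ⟨⊤, by simp, by simp, .top, by simp, by simp, 0,
      fun u _ ↦ LinearMap.ext fun v ↦ Subsingleton.elim _ _⟩
  obtain ⟨χ₀, hχ₀⟩ := exists_nontrivial_weightSpace_of_isSolvable K N V
  obtain ⟨⟨v, hv⟩, hv0⟩ := exists_ne (0 : weightSpace V χ₀)
  rw [mem_weightSpace] at hv
  have hv0 : v ≠ 0 := fun h ↦ hv0 (Subtype.ext h)
  let χ : N →ₗ⁅K⁆ K :=
    { χ₀ with
      map_lie' {x y} := by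
        have : χ₀ ⁅x, y⁆ • v = 0 := by
          rw [← hv, lie_lie, hv, hv, lie_smul, lie_smul, hv, hv, smul_smul, smul_smul, mul_comm,
            sub_self]
        simpa [LieRing.of_associative_ring_bracket, mul_comm, hv0] using this }
  have hχ (n : N) : ⁅n, v⁆ = χ n • v := hv n
  let W : LieSubmodule K N V :=
    { K ∙ v with
      lie_mem {n m} hm := by
        obtain ⟨c, rfl⟩ := Submodule.mem_span_singleton.mp hm
        rw [lie_smul, hχ]
        exact Submodule.smul_mem _ _ (Submodule.smul_mem _ _ (Submodule.mem_span_singleton_self v)) }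
  have hvW : v ∈ W := Submodule.mem_span_singleton_self v
  have hlt : finrank K (V ⧸ W) < d := by
    subst h
    have := W.toSubmodule.finrank_quotient_add_finrank
    have h1 : finrank K W.toSubmodule = 1 := finrank_span_singleton hv0
    change finrank K (V ⧸ W.toSubmodule) < _
    lia
  obtain ⟨P', hP'⟩ := ih _ hlt (V ⧸ W) rfl
  obtain ⟨k, hk⟩ := hP'.exists_pow
  have hker : (LinearMap.ker (lift K χ).toLinearMap).CoFG := .ker _
  -- One more power than for the quotient: `k + 1` factors push `V` into the line `K v`, and the
  -- last one kills `v`.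
  refine ⟨P' ⊓ LinearMap.ker (lift K χ).toLinearMap, ?_, ?_, hP'.coFG.inf hker, ?_, ?_, k + 1, ?_⟩
  · rintro a p ⟨hp1, hp2⟩
    refine ⟨hP'.mul_mem_left a p hp1, ?_⟩
    simp only [SetLike.mem_coe, LinearMap.mem_ker, AlgHom.toLinearMap_apply] at hp2 ⊢
    rw [map_mul, hp2, mul_zero]
  · rintro a p ⟨hp1, hp2⟩
    refine ⟨hP'.mul_mem_right a p hp1, ?_⟩
    simp only [SetLike.mem_coe, LinearMap.mem_ker, AlgHom.toLinearMap_apply] at hp2 ⊢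
    rw [map_mul, hp2, zero_mul]
  · rintro n ⟨m, hm⟩
    refine ⟨hP'.ι_mem_of_isNilpotent n ⟨m, ?_⟩, ?_⟩
    · ext x
      obtain ⟨x, rfl⟩ := LieSubmodule.Quotient.surjective_mk' W x
      have := LieModuleHom.map_lift_toEnd (LieSubmodule.Quotient.mk' W) (ι K n ^ m) x
      rw [map_pow, map_pow, lift_ι_apply, lift_ι_apply, hm] at this
      rw [← this]
      simp
    · simp only [SetLike.mem_coe, LinearMap.mem_ker, AlgHom.toLinearMap_apply, lift_ι_apply]
      have := lift_toEnd_apply_of_forall_lie_eq_smul hχ (ι K n ^ m)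
      rw [map_pow, map_pow, lift_ι_apply, lift_ι_apply, hm] at this
      exact eq_zero_of_pow_eq_zero ((smul_eq_zero_iff_left hv0).mp this.symm)
  · intro x y
    refine ⟨hP'.ι_lie_mem x y, ?_⟩
    simp only [SetLike.mem_coe, LinearMap.mem_ker, AlgHom.toLinearMap_apply, lift_ι_apply]
    rw [LieHom.map_lie, LieRing.of_associative_ring_bracket, mul_comm, sub_self]
  · intro u hu
    rw [pow_succ'] at hu
    induction hu using Submodule.mul_induction_on' with
    | mem_mul_mem p hp q hq =>
      ext x
      have hq' : q ∈ P' ^ (k + 1) := pow_le_pow_left' (inf_le_left (a := P')) (k + 1) hq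
      have h1 : LieSubmodule.Quotient.mk' W (lift K (toEnd K N V) q x) = 0 := by
        rw [LieModuleHom.map_lift_toEnd, hk q hq']; simp
      rw [LieSubmodule.Quotient.mk_eq_zero] at h1
      obtain ⟨c, hc⟩ := Submodule.mem_span_singleton.mp h1
      have hp2 : lift K χ p = 0 := hp.2
      rw [map_mul, Module.End.mul_apply, ← hc, map_smul,
        lift_toEnd_apply_of_forall_lie_eq_smul hχ, hp2]
      simp
    | add x _ y _ hx hy => rw [map_add, hx, hy, add_zero]

/-- The elements acting nilpotently form the preimage of the ideal `P` under `ι`, which is a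
subspace. -/
lemma isNilpotent_toEnd_add [LieAlgebra.IsSolvable N] {V : Type*} [AddCommGroup V]
    [Module K V] [LieRingModule N V] [LieModule K N V] [FiniteDimensional K V] {x y : N}
    (hx : IsNilpotent (toEnd K N V x)) (hy : IsNilpotent (toEnd K N V y)) :
    IsNilpotent (toEnd K N V (x + y)) := by
  obtain ⟨P, hP⟩ := exists_isNilradicalIdeal (K := K) (N := N) V
  refine hP.isNilpotent ?_
  rw [map_add]
  exact add_mem (hP.ι_mem_of_isNilpotent x hx) (hP.ι_mem_of_isNilpotent y hy)

lemma isNilpotent_toEnd_lie [LieAlgebra.IsSolvable N] {V : Type*} [AddCommGroup V]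
    [Module K V] [LieRingModule N V] [LieModule K N V] [FiniteDimensional K V] (x y : N) :
    IsNilpotent (toEnd K N V ⁅x, y⁆) := by
  obtain ⟨P, hP⟩ := exists_isNilradicalIdeal (K := K) (N := N) V
  exact hP.isNilpotent (hP.ι_lie_mem x y)

end

/-! ### Extending a representation through a quotient of `U(N)` -/

section

open Module LieModule UniversalEnvelopingAlgebra

/-- A derivation nilpotent on the generators is only locally nilpotent on `U(N)`. This becomes
nilpotency on a finite-dimensional quotient. -/
lemma isNilpotent_of_leibniz_of_isNilpotent {K N : Type*} [CommRing K] [LieRing N]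
    [LieAlgebra K N] {d : N →ₗ[K] N} (hd : IsNilpotent d)
    {D : UniversalEnvelopingAlgebra K N →ₗ[K] UniversalEnvelopingAlgebra K N}
    (hD : ∀ a b, D (a * b) = D a * b + a * D b) (hDι : ∀ n, D (ι K n) = ι K (d n))
    (a : UniversalEnvelopingAlgebra K N) : ∃ k, ∀ m ≥ k, (D ^ m) a = 0 := by
  have hzero {a : UniversalEnvelopingAlgebra K N} {k : ℕ} (h : (D ^ k) a = 0) :
      ∀ m ≥ k, (D ^ m) a = 0 := by
    intro m hm
    rw [← Nat.sub_add_cancel hm, pow_add, Module.End.mul_apply, h, map_zero]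
  induction a using UniversalEnvelopingAlgebra.induction with
  | ι_mem n =>
    obtain ⟨k, hk⟩ := hd
    have h (k : ℕ) : (D ^ k) (ι K n) = ι K ((d ^ k) n) := by
      induction k with
      | zero => simp
      | succ k ih => rw [pow_succ', pow_succ', Module.End.mul_apply, ih, hDι, Module.End.mul_apply]
    exact ⟨k, hzero (by rw [h, hk, LinearMap.zero_apply, map_zero])⟩
  | algebraMap_mem r =>
    have h1 : D 1 = 0 := by simpa using hD 1 1
    exact ⟨1, hzero (by rw [pow_one, Algebra.algebraMap_eq_smul_one, map_smul, h1, smul_zero])⟩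
  | add a b ha hb =>
    obtain ⟨k, hk⟩ := ha
    obtain ⟨l, hl⟩ := hb
    refine ⟨k + l, fun m hm ↦ ?_⟩
    rw [map_add, hk m (by lia), hl m (by lia), add_zero]
  | mul a b ha hb =>
    obtain ⟨k, hk⟩ := ha
    obtain ⟨l, hl⟩ := hb
    -- Tracking both exponents replaces the binomial Leibniz formula: each application of `D` raises
    -- `i` or `j`, and at `s = 0` one factor vanishes.
    have key (s : ℕ) : ∀ i j, i + j + s ≥ k + l → (D ^ s) ((D ^ i) a * (D ^ j) b) = 0 := by
      induction s with
      | zero =>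
        intro i j hij
        rcases le_or_gt k i with h | h
        · simp [hk i h]
        · simp [hl j (by lia)]
      | succ s ih =>
        intro i j hij
        rw [pow_succ, Module.End.mul_apply, hD, map_add, ← Module.End.mul_apply D,
          ← Module.End.mul_apply D, ← pow_succ', ← pow_succ', ih (i + 1) j (by lia),
          ih i (j + 1) (by lia), add_zero]
    exact ⟨k + l, fun m hm ↦ by simpa using key m 0 0 (by lia)⟩

variable {K L : Type*} [Field K] [LieRing L] [LieAlgebra K L]

-- Here `π` is the projection onto `N` along a complementary subalgebra. The operator `T x = D x +
-- (right multiplication by π x)` is left multiplication for `x` in `N` and a derivation when `π x =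
-- 0`. The condition `hπ_lie` is what makes `T` respect brackets, since right multiplication
-- reverses products.
open Submodule in
theorem IsNilradicalIdeal.exists_extension {N : LieIdeal K L} [FiniteDimensional K N]
    {V : Type*} [AddCommGroup V] [Module K V] [LieRingModule N V] [LieModule K N V]
    {P : Submodule K (UniversalEnvelopingAlgebra K N)} (hP : IsNilradicalIdeal K N V P)
    (hnil : ∀ (x : L) (n : N), IsNilpotent (toEnd K N V ⁅x, n⁆))
    {π : L →ₗ[K] N} (hπ : ∀ n : N, π n = n)
    (hπ_lie : ∀ x y, π ⁅x, y⁆ = ⁅x, π y⁆ - ⁅y, π x⁆ - ⁅π x, π y⁆) :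
    ∃ (m : ℕ) (Φ : L →ₗ⁅K⁆ End K (Fin m → K)),
      (∀ n : N, Φ n = 0 → toEnd K N V n = 0) ∧
      (∀ n : N, IsNilpotent (toEnd K N V n) → IsNilpotent (Φ n)) ∧
      ∀ x, π x = 0 → IsNilpotent (LieAlgebra.ad K L x) → IsNilpotent (Φ x) := by
  obtain ⟨k, hk⟩ := hP.exists_pow
  let A := UniversalEnvelopingAlgebra K N
  have hD (x : L) := exists_leibniz (K := K) (toEnd K L N x) fun n m ↦ by
    ext; simp
  choose D hD hDι using hD
  have hD_add (x y : L) : D (x + y) = D x + D y :=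
    eq_of_leibniz (hD _) (fun a b ↦ by simp [hD]; noncomm_ring) fun n ↦ by
      rw [LinearMap.add_apply, hDι, hDι, hDι, ← map_add]; simp
  have hD_smul (c : K) (x : L) : D (c • x) = c • D x :=
    eq_of_leibniz (hD _) (fun a b ↦ by simp [hD]) fun n ↦ by
      rw [LinearMap.smul_apply, hDι, hDι, ← map_smul]; simp
  have hD_lie (x y : L) : D ⁅x, y⁆ = D x * D y - D y * D x :=
    eq_of_leibniz (hD _) (fun a b ↦ by simp [hD]; noncomm_ring) fun n ↦ by
      rw [LinearMap.sub_apply, Module.End.mul_apply, Module.End.mul_apply, hDι, hDι, hDι, hDι,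
        hDι, ← map_sub]
      simp
  have hD_self (n : N) (a : A) : D n a = ι K n * a - a * ι K n := by
    have : D n = LinearMap.mulLeft K (ι K n) - LinearMap.mulRight K (ι K n) :=
      eq_of_leibniz (hD _) (fun a b ↦ by simp; noncomm_ring) fun m ↦ by
        rw [hDι]
        simp only [LinearMap.sub_apply, LinearMap.mulLeft_apply, LinearMap.mulRight_apply]
        rw [← LieRing.of_associative_ring_bracket, ← LieHom.map_lie]
        rfl
    rw [this]
    rfl
  -- Each `⁅x, n⁆` acts nilpotently, hence lies in `P`, and the Leibniz rule does the rest. So `D x`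
  -- preserves `P` and its powers.
  have hDP (x : L) (a : A) : D x a ∈ P := by
    have h1 : D x 1 = 0 := by simpa using hD x 1 1
    induction a using UniversalEnvelopingAlgebra.induction with
    | ι_mem n => rw [hDι]; exact hP.ι_mem_of_isNilpotent _ (hnil x n)
    | algebraMap_mem r => simp [Algebra.algebraMap_eq_smul_one, h1]
    | add a b ha hb => rw [map_add]; exact add_mem ha hb
    | mul a b ha hb =>
      rw [hD]
      exact add_mem (hP.mul_mem_right b _ ha) (hP.mul_mem_left a _ hb)
  let J : Submodule K A := P ^ (k + 1)
  let T (x : L) : A →ₗ[K] A := D x + LinearMap.mulRight K (ι K (π x))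
  have hT (x : L) (a : A) : T x a = D x a + a * ι K (π x) := rfl
  have hTJ (x : L) : J ≤ J.comap (T x) := fun p hp ↦
    add_mem (map_mem_pow_succ_of_leibniz (hD x) (fun p _ ↦ hDP x p) k hp)
      (mul_mem_pow_succ_right hP.mul_mem_right k _ hp)
  have hT_self (n : N) (a : A) : T n a = ι K n * a := by
    rw [hT, hD_self, hπ]; abel
  let Φ : L →ₗ⁅K⁆ End K (A ⧸ J) :=
    { toFun x := J.mapQ J (T x) (hTJ x)
      map_add' x y := by
        ext a
        simp only [LinearMap.comp_apply, mapQ_apply, mkQ_apply, LinearMap.add_apply, hT, hD_add,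
          map_add, ← Submodule.Quotient.mk_add]
        congr 1
        noncomm_ring
      map_smul' c x := by
        ext a
        simp only [LinearMap.comp_apply, mapQ_apply, mkQ_apply, LinearMap.smul_apply, hT, hD_smul,
          map_smul, ← Submodule.Quotient.mk_smul, RingHom.id_apply, mul_smul_comm, smul_add]
      map_lie' {x y} := by
        ext a
        rw [LieRing.of_associative_ring_bracket]
        simp only [LinearMap.comp_apply, mapQ_apply, mkQ_apply, LinearMap.sub_apply, hT, hD_lie,
          hπ_lie, map_sub, ← Submodule.Quotient.mk_sub, Module.End.mul_apply, map_add, hD, hDι]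
        congr 1
        have h : ι K ⁅π x, π y⁆ = ι K (π x) * ι K (π y) - ι K (π y) * ι K (π x) := by
          rw [LieHom.map_lie, LieRing.of_associative_ring_bracket]
        rw [h, toEnd_apply_apply, toEnd_apply_apply]
        simp only [mul_sub, add_mul, mul_assoc]
        abel }
  have hG : (LinearMap.range (ι K : N →ₗ⁅K⁆ UniversalEnvelopingAlgebra K N).toLinearMap).FG := by
    rw [LinearMap.range_eq_map]; exact Module.Finite.fg_top.map _
  have hJ : J.CoFG := coFG_pow_succ hG (by rw [LinearMap.coe_range]; exact adjoin_range_ι)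
    hP.mul_mem_left hP.coFG k
  have : Module.Finite K (A ⧸ J) := hJ
  let e := (finBasis K (A ⧸ J)).equivFun.conjAlgEquiv K
  refine ⟨_, (AlgHom.toLieHom e.toAlgHom).comp Φ, fun n hn ↦ ?_, fun n hn ↦ ?_, fun x hx hx' ↦ ?_⟩
  · have h0 : Φ n = 0 := e.injective (by simpa using hn)
    -- Evaluating at `1` shows that `n` lies in `J`, which annihilates `V`.
    have h1 : J.mkQ (T n 1) = 0 := congr($h0 (J.mkQ 1))
    rw [hT_self, mul_one, mkQ_apply, Submodule.Quotient.mk_eq_zero] at h1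
    rw [← lift_ι_apply K (toEnd K N V), hk _ h1]
  · suffices IsNilpotent (Φ n) from this.map e
    refine ⟨k + 1, ?_⟩
    have h (i : ℕ) (a : A) : (Φ n ^ i) (J.mkQ a) = J.mkQ (ι K n ^ i * a) := by
      induction i with
      | zero => simp
      | succ i ih =>
        rw [pow_succ', Module.End.mul_apply, ih, pow_succ', mul_assoc, ← hT_self]
        rfl
    ext a
    simp only [LinearMap.comp_apply, LinearMap.zero_apply]
    rw [h, mkQ_apply, Submodule.Quotient.mk_eq_zero]
    have := pow_mem_pow _ (hP.ι_mem_of_isNilpotent n hn) (k + 1)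
    exact mul_mem_pow_succ_right hP.mul_mem_right k a this
  · suffices IsNilpotent (Φ x) from this.map e
    rw [Module.End.isNilpotent_iff_of_finite]
    intro w
    obtain ⟨a, rfl⟩ := J.mkQ_surjective w
    have hd : IsNilpotent (toEnd K L N x) := by
      obtain ⟨i, hi⟩ := hx'
      refine ⟨i, LinearMap.ext fun n ↦ Subtype.ext ?_⟩
      have h (i : ℕ) : (((toEnd K L N x) ^ i) n : L) = (LieAlgebra.ad K L x ^ i) n := by
        induction i with
        | zero => simp
        | succ i ih =>
          rw [pow_succ', pow_succ', Module.End.mul_apply, Module.End.mul_apply, ← ih]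
          simp
      rw [h, hi]
      rfl
    obtain ⟨m, hm⟩ := isNilpotent_of_leibniz_of_isNilpotent hd (hD x) (hDι x) a
    refine ⟨m, ?_⟩
    have h (i : ℕ) (a : A) : (Φ x ^ i) (J.mkQ a) = J.mkQ ((D x ^ i) a) := by
      induction i with
      | zero => simp
      | succ i ih =>
        rw [pow_succ', Module.End.mul_apply, ih, pow_succ', Module.End.mul_apply]
        change J.mkQ (T x _) = _
        rw [hT, hx, map_zero, mul_zero, add_zero]
    rw [h, hm m le_rfl, map_zero]

end

/-! ### Ado's theorem for solvable algebras -/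

section

open Module LieModule

variable {K L : Type*} [Field K] [LieRing L] [LieAlgebra K L]

/-- A finite-dimensional algebra embeds in the endomorphism algebra of some `Kⁿ`. -/
lemma exists_injective_algHom_end (K A : Type*) [Field K] [Ring A] [Algebra K A]
    [FiniteDimensional K A] :
    ∃ (n : ℕ) (f : A →ₐ[K] End K (Fin n → K)), Function.Injective f := by
  let e := (finBasis K A).equivFun.conjAlgEquiv K
  exact ⟨_, e.toAlgHom.comp (Algebra.lmul K A), e.injective.comp Algebra.lmul_injective⟩

/-- The product of two representations, as a representation on some `Kⁿ`. -/
lemma exists_prod_representation {A B : Type*} [Ring A] [Algebra K A] [FiniteDimensional K A]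
    [Ring B] [Algebra K B] [FiniteDimensional K B] (f : L →ₗ⁅K⁆ A) (g : L →ₗ⁅K⁆ B) :
    ∃ (n : ℕ) (Ψ : L →ₗ⁅K⁆ End K (Fin n → K)), (∀ x, Ψ x = 0 → f x = 0 ∧ g x = 0) ∧
      ∀ x, IsNilpotent (f x) → IsNilpotent (g x) → IsNilpotent (Ψ x) := by
  obtain ⟨n, j, hj⟩ := exists_injective_algHom_end K (A × B)
  let h : L →ₗ⁅K⁆ A × B :=
    { f.toLinearMap.prod g.toLinearMap with
      map_lie' {x y} := by
        simp only [LieRing.of_associative_ring_bracket]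
        ext <;> simp [LieRing.of_associative_ring_bracket] }
  refine ⟨n, j.toLieHom.comp h, fun x hx ↦ ?_, fun x hf hg ↦ ?_⟩
  · have : h x = 0 := hj (by simpa using hx)
    exact Prod.ext_iff.mp this
  · suffices IsNilpotent (h x) from this.map j
    obtain ⟨k, hk⟩ := hf
    obtain ⟨l, hl⟩ := hg
    refine ⟨k + l, Prod.ext ?_ ?_⟩
    · change f x ^ (k + l) = 0
      rw [pow_add, hk, zero_mul]
    · change g x ^ (k + l) = 0
      rw [pow_add, hl, mul_zero]

lemma LieIdeal.isNilpotent_ad_of_isNilpotent_ad {N : LieIdeal K L} {n : N}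
    (h : IsNilpotent (LieAlgebra.ad K L n)) : IsNilpotent (LieAlgebra.ad K N n) :=
  LieSubalgebra.isNilpotent_ad_of_isNilpotent_ad (N : LieSubalgebra K L) (x := n) h

variable [CharZero K] [IsAlgClosed K]

lemma LieHom.isNilpotent_map_add [LieAlgebra.IsSolvable L] {V : Type*} [AddCommGroup V]
    [Module K V] [FiniteDimensional K V] (ρ : L →ₗ⁅K⁆ End K V) {x y : L}
    (hx : IsNilpotent (ρ x)) (hy : IsNilpotent (ρ y)) : IsNilpotent (ρ (x + y)) := by
  let := LieRingModule.compLieHom V ρ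
  have := LieModule.compLieHom V ρ
  exact isNilpotent_toEnd_add (K := K) (N := L) (V := V) hx hy

/-- **Zassenhaus extension**: a representation `ρ` of a solvable ideal `N` such that `[L, N]` acts
nilpotently gives rise to a representation of `L` whose kernel meets `N` in the kernel of `ρ`. -/
theorem LieIdeal.exists_extension {N : LieIdeal K L} [LieAlgebra.IsSolvable N]
    [FiniteDimensional K N] {V : Type*} [AddCommGroup V] [Module K V] [FiniteDimensional K V]
    (ρ : N →ₗ⁅K⁆ End K V) (hnil : ∀ (x : L) (n : N), IsNilpotent (ρ ⁅x, n⁆))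
    {H : LieSubalgebra K L} (hH : IsCompl N.toSubmodule H.toSubmodule) :
    ∃ (m : ℕ) (Φ : L →ₗ⁅K⁆ End K (Fin m → K)),
      (∀ n : N, Φ n = 0 → ρ n = 0) ∧
      (∀ n : N, IsNilpotent (ρ n) → IsNilpotent (Φ n)) ∧
      ∀ x ∈ H, IsNilpotent (LieAlgebra.ad K L x) → IsNilpotent (Φ x) := by
  let := LieRingModule.compLieHom V ρ
  have := LieModule.compLieHom V ρ
  obtain ⟨P, hP⟩ := exists_isNilradicalIdeal (K := K) (N := N) V
  let π : L →ₗ[K] N := N.toSubmodule.projectionOnto H.toSubmodule hH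
  have hπ (n : N) : π n = n := Submodule.projectionOnto_apply_left hH n
  have hπ_zero {x : L} : π x = 0 ↔ x ∈ H := Submodule.projectionOnto_apply_eq_zero_iff hH
  have hπ_mem (x : L) : x - π x ∈ H := by rw [← hπ_zero, map_sub, hπ, sub_self]
  obtain ⟨m, Φ, h1, h2, h3⟩ := hP.exists_extension hnil hπ fun x y ↦ by
    have h : ⁅x, y⁆ = (⁅x, π y⁆ - ⁅y, π x⁆ - ⁅π x, π y⁆ : N) + ⁅x - π x, y - π y⁆ := by
      have h' : ((⁅π x, π y⁆ : N) : L) = ⁅(π x : L), (π y : L)⁆ := rfl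
      simp only [LieSubmodule.coe_sub, LieSubmodule.coe_bracket, h', sub_lie, lie_sub]
      rw [← lie_skew y (π x : L)]
      abel
    rw [h, map_add, hπ, hπ_zero.mpr (H.lie_mem (hπ_mem x) (hπ_mem y)), add_zero]
  exact ⟨m, Φ, h1, h2, fun x hx ↦ h3 x (hπ_zero.mpr hx)⟩

/-- **Ado's theorem** for solvable Lie algebras, with control of nilpotent elements. -/
theorem LieAlgebra.IsSolvable.exists_injective_representation [FiniteDimensional K L]
    [LieAlgebra.IsSolvable L] :
    ∃ (m : ℕ) (ρ : L →ₗ⁅K⁆ End K (Fin m → K)), Function.Injective ρ ∧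
      ∀ x, IsNilpotent (LieAlgebra.ad K L x) → IsNilpotent (ρ x) := by
  induction hd : finrank K L using Nat.strong_induction_on generalizing L with
  | _ d ih =>
  rcases subsingleton_or_nontrivial L with hL | hL
  · exact ⟨0, 0, Function.injective_of_subsingleton _, fun x _ ↦ by simp⟩
  -- Any hyperplane containing the derived algebra is an ideal.
  obtain H | ⟨N, hN, hLN⟩ := eq_top_or_exists_le_coatom (derivedSeries K L 1).toSubmodule
  · rw [LieSubmodule.toSubmodule_eq_top] at H
    exact ((derivedSeries_lt_top_of_solvable K L).ne H).elim
  have hmemN (x y : L) : ⁅x, y⁆ ∈ N :=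
    hLN <| LieSubmodule.lie_mem_lie (LieSubmodule.mem_top _) (LieSubmodule.mem_top _)
  lift N to LieIdeal K L
  · exact fun _ ↦ hmemN _ _
  have hlt : finrank K N < d := hd ▸ Submodule.finrank_lt hN.lt_top.ne
  obtain ⟨m, ρ, hρ, hρnil⟩ := ih _ hlt (L := N) rfl
  have hρnil (n : N) (hn : IsNilpotent (LieAlgebra.ad K L n)) : IsNilpotent (ρ n) :=
    hρnil n (LieIdeal.isNilpotent_ad_of_isNilpotent_ad hn)
  -- The complement is spanned by an ad-nilpotent element whenever one exists outside `N`. The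
  -- control of nilpotent elements depends on this choice.
  obtain ⟨x, hxN, hx⟩ : ∃ x, x ∉ N ∧ ∀ y ∉ N, IsNilpotent (LieAlgebra.ad K L y) →
      IsNilpotent (LieAlgebra.ad K L x) := by
    by_cases h : ∃ y ∉ N, IsNilpotent (LieAlgebra.ad K L y)
    · obtain ⟨y, hy, hy'⟩ := h
      exact ⟨y, hy, fun _ _ _ ↦ hy'⟩
    · obtain ⟨y, hy⟩ : ∃ y, y ∉ N.toSubmodule := by
        by_contra! hall
        exact hN.ne_top (Submodule.eq_top_iff'.mpr hall)
      exact ⟨y, hy, fun z hz hz' ↦ absurd ⟨z, hz, hz'⟩ h⟩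
  let H : LieSubalgebra K L :=
    { K ∙ x with
      lie_mem' {a b} ha hb := by
        obtain ⟨r, rfl⟩ := Submodule.mem_span_singleton.mp ha
        obtain ⟨s, rfl⟩ := Submodule.mem_span_singleton.mp hb
        simp }
  have hH : IsCompl N.toSubmodule H.toSubmodule :=
    Submodule.isCompl_span_singleton_of_isCoatom_of_notMem hN hxN
  have hxH : x ∈ H := Submodule.mem_span_singleton_self x
  have hdecomp (y : L) : ∃ (n : N) (c : K), y = n + c • x := by
    have hy : y ∈ N.toSubmodule ⊔ H.toSubmodule := by rw [hH.sup_eq_top]; exact Submodule.mem_top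
    obtain ⟨n, hn, z, hz, rfl⟩ := Submodule.mem_sup.mp hy
    obtain ⟨c, rfl⟩ := Submodule.mem_span_singleton.mp hz
    exact ⟨⟨n, hn⟩, c, rfl⟩
  obtain ⟨m', Φ, hΦ1, hΦ2, hΦ3⟩ := LieIdeal.exists_extension ρ
    (fun y n ↦ hρnil _ (isNilpotent_toEnd_lie (K := K) (V := L) y (n : L))) hH
  obtain ⟨f, hfx, hf⟩ := Submodule.exists_le_ker_of_notMem (p := N.toSubmodule) hxN
  -- A nilpotent representation of the abelian quotient `L / N`: it detects the `x`-component that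
  -- `Φ` may miss, without spoiling nilpotency.
  let g : L →ₗ⁅K⁆ Matrix (Fin 2) (Fin 2) K :=
    { Matrix.singleLinearMap K (0 : Fin 2) (1 : Fin 2) ∘ₗ f with
      map_lie' {y z} := by
        have : f ⁅y, z⁆ = 0 := hf (hmemN y z)
        simp [this, LieRing.of_associative_ring_bracket] }
  have hg (y : L) : g y = Matrix.single 0 1 (f y) := rfl
  obtain ⟨k, Ψ, hΨ1, hΨ2⟩ := exists_prod_representation Φ g
  refine ⟨k, Ψ, ?_, fun y hy ↦ hΨ2 y ?_ ⟨2, by simp [hg, pow_two]⟩⟩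
  · refine (injective_iff_map_eq_zero Ψ).mpr fun y hy ↦ ?_
    obtain ⟨h1, h2⟩ := hΨ1 y hy
    obtain ⟨n, c, rfl⟩ := hdecomp y
    have hfn : f n = 0 := hf n.2
    have hc : c = 0 := by
      have := congr_fun (congr_fun h2 0) 1
      simpa [hg, hfn, hfx] using this
    subst hc
    rw [zero_smul, add_zero] at h1 ⊢
    rw [(injective_iff_map_eq_zero ρ).mp hρ n (hΦ1 n h1)]
    rfl
  · by_cases hyN : y ∈ N
    · exact hΦ2 ⟨y, hyN⟩ (hρnil ⟨y, hyN⟩ hy)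
    · have hx := hx y hyN hy
      obtain ⟨n, c, rfl⟩ := hdecomp y
      -- Both `y` and `x` are ad-nilpotent, hence so is `n = y - c • x`. Then `Φ y` is a sum of
      -- nilpotents from a solvable algebra.
      have hn : IsNilpotent (LieAlgebra.ad K L n) := by
        have := LieHom.isNilpotent_map_add (LieAlgebra.ad K L) hy (y := -c • x)
          (by rw [map_smul]; exact hx.smul _)
        simpa using this
      refine LieHom.isNilpotent_map_add Φ (hΦ2 n (hρnil n hn)) ?_
      rw [map_smul]
      exact (hΦ3 x hxH hx).smul _

end

/-! ### Cartan's criterion and Casimir operators -/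

section

open Module LieModule

namespace LieAlgebra

variable {K S V : Type*} [Field K] [LieRing S] [LieAlgebra K S] [AddCommGroup V] [Module K V]
  [LieRingModule S V] [LieModule K S V]

lemma isSolvable_of_derivedSeries_one [IsSolvable (derivedSeries K S 1)] : IsSolvable S := by
  obtain ⟨k, hk⟩ := IsSolvable.solvable K (derivedSeries K S 1)
  rw [LieIdeal.derivedSeries_eq_bot_iff] at hk
  exact IsSolvable.mk (R := K) (k := k + 1) (by rwa [derivedSeries_def, derivedSeriesOfIdeal_add])

lemma isNilpotent_of_injective_toEnd [FiniteDimensional K V] [LieModule.IsNilpotent S V]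
    (h : Function.Injective (toEnd K S V)) : LieRing.IsNilpotent S := by
  have : FiniteDimensional K S := .of_injective (toEnd K S V).toLinearMap h
  rw [LieAlgebra.isNilpotent_iff_forall (R := K)]
  intro x
  obtain ⟨k, hk⟩ := ad_nilpotent_of_nilpotent (R := K)
    (isNilpotent_toEnd_of_isNilpotent K S V x)
  refine ⟨k, LinearMap.ext fun y ↦ h ?_⟩
  have key (k : ℕ) :
      toEnd K S V ((ad K S x ^ k) y) = (ad K (End K V) (toEnd K S V x) ^ k) (toEnd K S V y) := by
    induction k with
    | zero => simp
    | succ k ih =>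
      rw [pow_succ', pow_succ', Module.End.mul_apply, Module.End.mul_apply, ← ih, ad_apply,
        ad_apply, LieHom.map_lie]
  rw [key, hk]
  simp

/-- **Cartan's criterion**: an algebra acting faithfully with vanishing trace form is solvable. -/
lemma isSolvable_of_traceForm_eq_zero [CharZero K] [FiniteDimensional K V]
    (h : Function.Injective (toEnd K S V)) (h0 : traceForm K S V = 0) : IsSolvable S := by
  have := isNilpotent_derivedSeries_of_traceForm_eq_zero h0
  have : LieRing.IsNilpotent (derivedSeries K S 1) :=
    isNilpotent_of_injective_toEnd (K := K) (V := V) (h.comp Subtype.val_injective)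
  exact isSolvable_of_derivedSeries_one (K := K)

variable [CharZero K] [FiniteDimensional K V] [HasTrivialRadical K S]

/-- The part of `C` in the radical of the trace form is an ideal acting faithfully with zero trace
form. Cartan's criterion makes it solvable, hence zero. -/
lemma eq_zero_of_traceForm_eq_zero_of_mem {C : LieIdeal K S}
    (hC : LieModule.ker K S V ⊓ C = ⊥) {x : S} (hx : x ∈ C)
    (h : ∀ y, traceForm K S V x y = 0) : x = 0 := by
  let J : LieIdeal K S := C ⊓
    { LinearMap.ker (traceForm K S V) with
      lie_mem {z w} hw := by
        ext y
        have hw : traceForm K S V w = 0 := hw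
        rw [traceForm_apply_lie_apply', hw]
        simp }
  have hJ : IsSolvable J := by
    refine isSolvable_of_traceForm_eq_zero (K := K) (V := V) ?_ ?_
    · refine (injective_iff_map_eq_zero _).mpr fun y hy ↦ Subtype.ext ?_
      have : (y : S) ∈ LieModule.ker K S V ⊓ C := ⟨(LieModule.mem_ker K S V y).mpr
        fun m ↦ congr($hy m), y.2.1⟩
      rwa [hC] at this
    · ext y z
      have : traceForm K S V y = 0 := y.2.2
      exact congr($this z)
  have hJ0 : J = ⊥ := HasTrivialRadical.eq_bot_of_isSolvable J
  have : x ∈ J := ⟨hx, LinearMap.ext h⟩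
  rwa [hJ0] at this

/-- A semisimple Lie algebra acting non-trivially has a Casimir operator of non-zero trace. -/
lemma exists_casimir [FiniteDimensional K S] (hne : ∃ x : S, toEnd K S V x ≠ 0) :
    ∃ c : End K V, (∀ (x : S) v, ⁅x, c v⁆ = c ⁅x, v⁆) ∧ LinearMap.trace K V c ≠ 0 ∧
      ∀ U : Submodule K V, (∀ (x : S) v, ⁅x, v⁆ ∈ U) → ∀ v, c v ∈ U := by
  let I := LieModule.ker K S V
  -- Only the complement of the kernel acts faithfully, so the trace form is nondegenerate there.
  -- The Casimir element is built from `C`, and its trace is `dim C`.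
  let C := I.killingCompl
  have hIC : IsCompl I C := I.isCompl_killingCompl
  let B := traceForm K C V
  have hBsymm : B.IsSymm := ⟨traceForm_comm K C V⟩
  have hI {x : S} (hx : x ∈ I) : toEnd K S V x = 0 :=
    LinearMap.ext fun m ↦ (LieModule.mem_ker K S V x).mp hx m
  have hB : B.Nondegenerate := by
    refine hBsymm.isRefl.nondegenerate_iff_separatingLeft.mpr fun x hx ↦ Subtype.ext ?_
    refine eq_zero_of_traceForm_eq_zero_of_mem (V := V) hIC.inf_eq_bot x.2 fun y ↦ ?_
    have hy : y ∈ I ⊔ C := by rw [hIC.sup_eq_top]; exact LieSubmodule.mem_top _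
    obtain ⟨i, hi, c, hc, rfl⟩ := (LieSubmodule.mem_sup _ _ _).mp hy
    have h1 : traceForm K S V x i = 0 := by simp [traceForm_apply_apply, hI hi]
    have h2 : traceForm K S V x c = 0 := hx ⟨c, hc⟩
    rw [map_add, h1, h2, add_zero]
  let b := finBasis K C
  let b' := LinearMap.BilinForm.dualBasis B hB b
  have hb'b (j k) : B (b' j) (b k) = if k = j then 1 else 0 :=
    LinearMap.BilinForm.apply_dualBasis_left hB b j k
  have hb (z : C) : z = ∑ j, B (b' j) z • b j := by
    have hrepr (j) : B (b' j) z = b.repr z j := by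
      conv_lhs => rw [← b.sum_repr z]
      simp only [map_sum, map_smul, hb'b]
      simp
    simp_rw [hrepr, b.sum_repr]
  have hb' (z : C) : z = ∑ j, B z (b j) • b' j := by
    conv_lhs => rw [← b'.sum_repr z]
    exact Finset.sum_congr rfl fun j _ ↦ by
      rw [LinearMap.BilinForm.dualBasis_repr_apply]
  let φ : S →ₗ[K] End K V := (toEnd K S V).toLinearMap
  have hφ (x y : S) : φ x * φ y = φ ⁅x, y⁆ + φ y * φ x := by
    have : φ ⁅x, y⁆ = φ x * φ y - φ y * φ x := LieHom.map_lie (toEnd K S V) x y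
    rw [this, sub_add_cancel]
  let ψ : C →ₗ[K] End K V := φ ∘ₗ C.toSubmodule.subtype
  let c : End K V := ∑ i, ψ (b i) * ψ (b' i)
  refine ⟨c, fun x v ↦ ?_, ?_, fun U hU v ↦ ?_⟩
  · suffices φ x * c = c * φ x from congr($this v)
    have key (i) : φ x * (ψ (b i) * ψ (b' i)) =
        ψ (b i) * ψ (b' i) * φ x + (ψ ⁅x, b i⁆ * ψ (b' i) + ψ (b i) * ψ ⁅x, b' i⁆) := by
      have h1 : φ x * ψ (b i) = ψ ⁅x, b i⁆ + ψ (b i) * φ x := hφ x (b i)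
      have h2 : φ x * ψ (b' i) = ψ ⁅x, b' i⁆ + ψ (b' i) * φ x := hφ x (b' i)
      rw [← mul_assoc, h1, add_mul, mul_assoc, h2]
      noncomm_ring
    have hzero : ∑ i, (ψ ⁅x, b i⁆ * ψ (b' i) + ψ (b i) * ψ ⁅x, b' i⁆) = 0 := by
      rw [Finset.sum_add_distrib]
      have h1 (i) : ψ ⁅x, b i⁆ * ψ (b' i) = ∑ j, B (b' j) ⁅x, b i⁆ • (ψ (b j) * ψ (b' i)) := by
        conv_lhs => rw [hb ⁅x, b i⁆]
        simp [Finset.sum_mul]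
      have h2 (i) : ψ (b i) * ψ ⁅x, b' i⁆ = ∑ j, B ⁅x, b' i⁆ (b j) • (ψ (b i) * ψ (b' j)) := by
        conv_lhs => rw [hb' ⁅x, b' i⁆]
        simp [Finset.mul_sum]
      simp_rw [h1, h2]
      rw [Finset.sum_comm, ← Finset.sum_add_distrib]
      refine Finset.sum_eq_zero fun i _ ↦ ?_
      rw [← Finset.sum_add_distrib]
      refine Finset.sum_eq_zero fun j _ ↦ ?_
      -- Invariance of the trace form makes the two families of coefficients cancel.
      have : B ⁅x, b' i⁆ (b j) = - B (b' i) ⁅x, b j⁆ :=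
        traceForm_apply_lie_apply' K S V x (b' i) (b j)
      rw [this, neg_smul, add_neg_cancel]
    rw [Finset.mul_sum, Finset.sum_mul]
    simp_rw [key]
    rw [Finset.sum_add_distrib, hzero, add_zero]
  · have htr : LinearMap.trace K V c = ∑ i, B (b i) (b' i) := by
      rw [map_sum]; rfl
    have hone (i) : B (b i) (b' i) = 1 := by
      rw [LinearMap.BilinForm.apply_dualBasis_right hB hBsymm, if_pos rfl]
    rw [htr]
    simp only [hone, Finset.sum_const, Finset.card_univ, Fintype.card_fin, nsmul_eq_mul, mul_one,
      ne_eq, Nat.cast_eq_zero]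
    intro hC
    have : Subsingleton C := finrank_zero_iff.mp hC
    obtain ⟨x, hx⟩ := hne
    have hCbot : C = ⊥ := (LieSubmodule.eq_bot_iff C).mpr fun z hz ↦
      congr_arg Subtype.val (Subsingleton.elim (⟨z, hz⟩ : C) 0)
    have hItop : I = ⊤ := by simpa [hCbot] using hIC.sup_eq_top
    exact hx (hI (hItop ▸ LieSubmodule.mem_top x))
  · rw [LinearMap.sum_apply]
    exact sum_mem fun i _ ↦ hU (b i : S) _

end LieAlgebra

end

/-! ### Complete reducibility -/

section

open Module LieModule LieAlgebra

variable {K L : Type*} [Field K] [LieRing L] [LieAlgebra K L]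

/-- A Lie algebra homomorphism vanishing on an ideal factors through the quotient. -/
def LieIdeal.liftQuotient {L' : Type*} [LieRing L'] [LieAlgebra K L'] (I : LieIdeal K L)
    (f : L →ₗ⁅K⁆ L') (h : ∀ x ∈ I, f x = 0) : (L ⧸ I) →ₗ⁅K⁆ L' :=
  { I.toSubmodule.liftQ f.toLinearMap h with
    map_lie' {x y} := by
      induction x using Submodule.Quotient.induction_on
      induction y using Submodule.Quotient.induction_on
      exact LieHom.map_lie f _ _ }

/-- A relative form of **Weyl's theorem** on complete reducibility: vectors of `W` may be corrected
by vectors of `W₀` so as to be invariant modulo `W₁`, if `L` maps `W` to `W₀` and acts on `W / W₁`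
through a semisimple quotient. -/
theorem LieModule.exists_add_lie_mem [CharZero K] [FiniteDimensional K L]
    {M : Type*} [AddCommGroup M] [Module K M] [FiniteDimensional K M] [LieRingModule L M]
    [LieModule K L M] {I : LieIdeal K L} [HasTrivialRadical K (L ⧸ I)]
    {W₁ W₀ W : LieSubmodule K L M} (h₁₀ : W₁ ≤ W₀) (h₀ : W₀ ≤ W)
    (hL : ∀ (x : L), ∀ w ∈ W, ⁅x, w⁆ ∈ W₀) (hI : ∀ x ∈ I, ∀ w ∈ W, ⁅x, w⁆ ∈ W₁)
    {f : M} (hf : f ∈ W) : ∃ w ∈ W₀, ∀ x : L, ⁅x, f + w⁆ ∈ W₁ := by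
  induction hd : finrank K W₀ - finrank K W₁ using Nat.strong_induction_on
    generalizing W₁ W₀ W f with
  | _ d ih =>
  -- An intermediate `U` splits the problem: correct `f` modulo `U`, then correct the result modulo
  -- `W₁` inside the vectors that `L` maps into `U`. What remains is `W₀ / W₁` without proper
  -- non-zero submodules.
  by_cases hU : ∃ U : LieSubmodule K L M, W₁ < U ∧ U < W₀
  · obtain ⟨U, h₁U, hU₀⟩ := hU
    have hlt₁ : finrank K W₁ < finrank K U := Submodule.finrank_lt_finrank_of_lt h₁U
    have hlt₂ : finrank K U < finrank K W₀ := Submodule.finrank_lt_finrank_of_lt hU₀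
    obtain ⟨w, hw, hfw⟩ := ih _ (by lia) hU₀.le h₀ hL (fun x hx w hw ↦ h₁U.le (hI x hx w hw)) hf rfl
    let W' : LieSubmodule K L M :=
      { carrier := {v | v ∈ W ∧ ∀ x : L, ⁅x, v⁆ ∈ U}
        add_mem' ha hb := ⟨add_mem ha.1 hb.1, fun x ↦ by
          rw [lie_add]; exact add_mem (ha.2 x) (hb.2 x)⟩
        zero_mem' := ⟨zero_mem _, fun x ↦ by simp⟩
        smul_mem' c v hv := ⟨W.smul_mem c hv.1, fun x ↦ by
          rw [lie_smul]; exact U.smul_mem c (hv.2 x)⟩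
        lie_mem {x v} hv := ⟨W.lie_mem hv.1, fun y ↦ U.lie_mem (hv.2 x)⟩ }
    obtain ⟨w', hw', hfw'⟩ := ih _ (by lia) h₁U.le (W := W')
      (fun u hu ↦ ⟨h₀ (hU₀.le hu), fun x ↦ U.lie_mem hu⟩) (fun x w hw ↦ hw.2 x)
      (fun x hx w hw ↦ hI x hx w hw.1) (f := f + w) ⟨add_mem hf (h₀ hw), hfw⟩ rfl
    exact ⟨w + w', add_mem hw (hU₀.le hw'), by simpa only [add_assoc] using hfw'⟩
  have hU (U : LieSubmodule K L M) (h₁ : W₁ ≤ U) (h₂ : U ≤ W₀) : U = W₁ ∨ U = W₀ := by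
    by_contra! h
    exact hU ⟨U, h₁.lt_of_ne h.1.symm, h₂.lt_of_ne h.2⟩
  let N : LieSubmodule K L W := W₁.comap W.incl
  let q : W →ₗ⁅K,L⁆ W ⧸ N := LieSubmodule.Quotient.mk' N
  have hq0 {w : W} : q w = 0 ↔ (w : M) ∈ W₁ := LieSubmodule.Quotient.mk_eq_zero N
  have hqsurj : Function.Surjective q := LieSubmodule.Quotient.surjective_mk' N
  have hker : ∀ x ∈ I, toEnd K L (W ⧸ N) x = 0 := by
    intro x hx
    ext v
    obtain ⟨w, rfl⟩ := hqsurj v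
    rw [toEnd_apply_apply, ← LieModuleHom.map_lie, hq0.mpr (hI x hx w w.2), LinearMap.zero_apply]
  by_cases htriv : ∀ x : L, toEnd K L (W ⧸ N) x = 0
  · refine ⟨0, zero_mem _, fun x ↦ ?_⟩
    have := congr($(htriv x) (q ⟨f, hf⟩))
    rw [toEnd_apply_apply, ← LieModuleHom.map_lie, LinearMap.zero_apply, hq0] at this
    simpa using this
  push Not at htriv
  let ρ := I.liftQuotient (toEnd K L (W ⧸ N)) hker
  let := LieRingModule.compLieHom (W ⧸ N) ρ
  have := LieModule.compLieHom (W ⧸ N) ρ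
  obtain ⟨c, hc, htr, hcU⟩ := exists_casimir (K := K) (S := L ⧸ I) (V := W ⧸ N)
    (htriv.imp' (LieSubmodule.Quotient.mk) fun x hx ↦ hx)
  have hc (x : L) (v : W ⧸ N) : ⁅x, c v⁆ = c ⁅x, v⁆ := hc (LieSubmodule.Quotient.mk x) v
  let c' : (W ⧸ N) →ₗ⁅K,L⁆ (W ⧸ N) := { c with map_lie' {x v} := (hc x v).symm }
  let V₀ : Submodule K (W ⧸ N) := (W₀.comap W.incl).toSubmodule.map (q : W →ₗ[K] W ⧸ N)
  have hV₀ (v : W ⧸ N) : c v ∈ V₀ := by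
    refine hcU V₀ (fun x v ↦ ?_) v
    obtain ⟨x, rfl⟩ := LieSubmodule.Quotient.surjective_mk' I x
    obtain ⟨w, rfl⟩ := hqsurj v
    exact ⟨⁅x, w⁆, hL x w w.2, LieModuleHom.map_lie q x w⟩
  -- The Casimir operator `c` sends `W / W₁` into `W₀ / W₁`. If its kernel there is zero, it is
  -- bijective there and `f` can be moved into `ker c`. If the kernel is everything, then `c ^ 2 =
  -- 0`, against the non-zero trace.
  let U : LieSubmodule K L M := (c'.ker.comap q ⊓ W₀.comap W.incl).map W.incl
  have hmemU {w : W} : (w : M) ∈ U ↔ c (q w) = 0 ∧ (w : M) ∈ W₀ := by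
    constructor
    · intro h
      obtain ⟨w', hw', hww'⟩ := (LieSubmodule.mem_map _).mp h
      obtain rfl : w' = w := Subtype.ext hww'
      exact hw'
    · exact fun h ↦ (LieSubmodule.mem_map _).mpr ⟨w, h, rfl⟩
  have h₁U : W₁ ≤ U := fun w hw ↦ hmemU (w := ⟨w, h₀ (h₁₀ hw)⟩).mpr
    ⟨by rw [hq0.mpr hw, map_zero], h₁₀ hw⟩
  have hU₀ : U ≤ W₀ := by
    intro w hw
    obtain ⟨w', hw', rfl⟩ := (LieSubmodule.mem_map _).mp hw
    exact hw'.2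
  rcases hU U h₁U hU₀ with hUW | hUW
  · have hinj : Function.Injective (c.restrict (p := V₀) (q := V₀) fun v _ ↦ hV₀ v) := by
      refine (injective_iff_map_eq_zero _).mpr ?_
      rintro ⟨v, w, hw, rfl⟩ hv
      have : (w : M) ∈ U := hmemU.mpr ⟨congr_arg Subtype.val hv, hw⟩
      rw [hUW] at this
      exact Subtype.ext (hq0.mpr this)
    obtain ⟨⟨_, w, hw, rfl⟩, hw'⟩ :=
      (LinearMap.injective_iff_surjective.mp hinj) ⟨c (q ⟨f, hf⟩), hV₀ _⟩
    have hw' : c (q w) = c (q ⟨f, hf⟩) := congr_arg Subtype.val hw'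
    refine ⟨-w, neg_mem hw, fun x ↦ ?_⟩
    have : ((⁅x, ⟨f, hf⟩ - w⁆ : W) : M) ∈ U := by
      refine hmemU.mpr ⟨?_, hL x _ (sub_mem hf w.2)⟩
      rw [LieModuleHom.map_lie, ← hc, map_sub, map_sub, hw', sub_self, lie_zero]
    rw [hUW] at this
    simpa [sub_eq_add_neg] using this
  · refine absurd ?_ htr
    refine (LinearMap.isNilpotent_trace_of_isNilpotent ⟨2, LinearMap.ext fun v ↦ ?_⟩).eq_zero
    obtain ⟨w, hw, hwv⟩ := hV₀ v
    have hw : (w : M) ∈ U := hUW ▸ hw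
    rw [pow_two, Module.End.mul_apply, ← hwv]
    exact (hmemU.mp hw).1

end

/-! ### Levi decomposition -/

section

open Module LieModule LieAlgebra

universe u

namespace LieIdeal

variable {K : Type*} {L : Type u} [Field K] [LieRing L] [LieAlgebra K L]

/-- The quotient by `I` has no non-zero abelian ideals. -/
def IsSemisimpleQuotient (I : LieIdeal K L) : Prop :=
  ∀ J : LieIdeal K L, I ≤ J → (∀ x ∈ J, ∀ y ∈ J, ⁅x, y⁆ ∈ I) → J ≤ I

lemma IsSemisimpleQuotient.hasTrivialRadical {I : LieIdeal K L} (hI : I.IsSemisimpleQuotient) :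
    HasTrivialRadical K (L ⧸ I) := by
  rw [hasTrivialRadical_iff_no_abelian_ideals]
  intro J hJ
  let J' : LieIdeal K L :=
    { J.toSubmodule.comap I.toSubmodule.mkQ with
      lie_mem {x y} hy := J.lie_mem (x := (LieSubmodule.Quotient.mk x : L ⧸ I)) hy }
  have hJ' : J' ≤ I := by
    refine hI J' (fun x hx ↦ ?_) fun x hx y hy ↦ ?_
    · change I.toSubmodule.mkQ x ∈ J
      rw [show I.toSubmodule.mkQ x = 0 by simpa using hx]
      exact zero_mem J
    · have := congr_arg Subtype.val (trivial_lie_zero J J ⟨_, hx⟩ ⟨_, hy⟩)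
      exact (Submodule.Quotient.mk_eq_zero _).mp this
  refine (LieSubmodule.eq_bot_iff J).mpr fun x hx ↦ ?_
  obtain ⟨x, rfl⟩ := LieSubmodule.Quotient.surjective_mk' I x
  exact (LieSubmodule.Quotient.mk_eq_zero _).mpr (hJ' hx)

lemma isSemisimpleQuotient_radical [FiniteDimensional K L] :
    (radical K L).IsSemisimpleQuotient := by
  intro J hJ h
  rw [← LieIdeal.solvable_iff_le_radical]
  have hle : derivedSeriesOfIdeal K L 1 J ≤ radical K L := by
    rw [derivedSeriesOfIdeal_succ, derivedSeriesOfIdeal_zero, LieSubmodule.lieIdeal_oper_eq_span,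
      LieSubmodule.lieSpan_le]
    rintro _ ⟨x, y, rfl⟩
    exact h x x.2 y y.2
  obtain ⟨k, hk⟩ := IsSolvable.solvable K (radical K L)
  rw [LieIdeal.derivedSeries_eq_bot_iff] at hk
  refine IsSolvable.mk (R := K) (k := k + 1) ?_
  rw [LieIdeal.derivedSeries_eq_bot_iff, derivedSeriesOfIdeal_add]
  exact le_bot_iff.mp (hk ▸ derivedSeriesOfIdeal_mono hle k)

lemma lie_self_lt_of_isSolvable {I : LieIdeal K L} [IsSolvable I] (hI : I ≠ ⊥) : ⁅I, I⁆ < I := by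
  refine (LieSubmodule.lie_le_left I I).lt_of_ne fun h ↦ hI ?_
  obtain ⟨k, hk⟩ := IsSolvable.solvable K I
  rw [LieIdeal.derivedSeries_eq_bot_iff] at hk
  rw [← hk]
  clear hk
  induction k with
  | zero => rfl
  | succ k ih => rw [derivedSeriesOfIdeal_succ, ← ih, h]

/-- The base case of the Levi decomposition. -/
lemma exists_isCompl_of_abelian [CharZero K] [FiniteDimensional K L] {I : LieIdeal K L}
    [HasTrivialRadical K (L ⧸ I)] (habel : ∀ x ∈ I, ∀ y ∈ I, ⁅x, y⁆ = 0)
    (hcenter : I ≤ LieAlgebra.center K L ∨ I ⊓ LieAlgebra.center K L = ⊥) :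
    ∃ H : LieSubalgebra K L, IsCompl I.toSubmodule H.toSubmodule := by
  -- Whitehead's trick: a complement is sought through a projection onto `I` that is invariant
  -- modulo `ad I`. Here `W` holds the maps into `I` that are scalar on `I`, `W₀` those that vanish
  -- on `I`, and `W₁ = ad I`.
  let W : LieSubmodule K L (L →ₗ[K] L) :=
    { carrier := {f | (∀ y, f y ∈ I) ∧ ∃ r : K, ∀ a ∈ I, f a = r • a}
      add_mem' := by
        rintro f g ⟨hf, r, hr⟩ ⟨hg, s, hs⟩
        exact ⟨fun y ↦ add_mem (hf y) (hg y), r + s, fun a ha ↦ by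
          rw [LinearMap.add_apply, hr a ha, hs a ha, add_smul]⟩
      zero_mem' := ⟨fun y ↦ zero_mem I, 0, by simp⟩
      smul_mem' := by
        rintro c f ⟨hf, r, hr⟩
        exact ⟨fun y ↦ I.smul_mem c (hf y), c * r, fun a ha ↦ by
          rw [LinearMap.smul_apply, hr a ha, mul_smul]⟩
      lie_mem := by
        rintro x f ⟨hf, r, hr⟩
        refine ⟨fun y ↦ ?_, 0, fun a ha ↦ ?_⟩
        · rw [LieHom.lie_apply]
          exact sub_mem (I.lie_mem (hf y)) (hf _)
        · rw [LieHom.lie_apply, hr a ha, hr _ (I.lie_mem ha), lie_smul, sub_self, zero_smul] }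
  let W₀ : LieSubmodule K L (L →ₗ[K] L) :=
    { carrier := {f | (∀ y, f y ∈ I) ∧ ∀ a ∈ I, f a = 0}
      add_mem' := by
        rintro f g ⟨hf, hr⟩ ⟨hg, hs⟩
        exact ⟨fun y ↦ add_mem (hf y) (hg y), fun a ha ↦ by
          rw [LinearMap.add_apply, hr a ha, hs a ha, add_zero]⟩
      zero_mem' := ⟨fun y ↦ zero_mem I, by simp⟩
      smul_mem' := by
        rintro c f ⟨hf, hr⟩
        exact ⟨fun y ↦ I.smul_mem c (hf y), fun a ha ↦ by
          rw [LinearMap.smul_apply, hr a ha, smul_zero]⟩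
      lie_mem := by
        rintro x f ⟨hf, hr⟩
        refine ⟨fun y ↦ ?_, fun a ha ↦ ?_⟩
        · rw [LieHom.lie_apply]
          exact sub_mem (I.lie_mem (hf y)) (hf _)
        · rw [LieHom.lie_apply, hr a ha, hr _ (I.lie_mem ha), lie_zero, sub_self] }
  let W₁ : LieSubmodule K L (L →ₗ[K] L) :=
    { I.toSubmodule.map (ad K L).toLinearMap with
      lie_mem := by
        rintro x _ ⟨a, ha, rfl⟩
        refine ⟨⁅x, a⁆, I.lie_mem ha, LinearMap.ext fun y ↦ ?_⟩
        rw [LieHom.lie_apply]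
        simp }
  have hI_lie {a : L} (ha : a ∈ I) (y : L) : ⁅a, y⁆ ∈ I := lie_mem_left K L I a y ha
  let f : L →ₗ[K] L := I.toSubmodule.subtype ∘ₗ I.toSubmodule.subtype.leftInverse
  have hfI {a : L} (ha : a ∈ I) : f a = a := congr_arg Subtype.val
    (LinearMap.leftInverse_apply_of_inj I.toSubmodule.ker_subtype ⟨a, ha⟩)
  have hfW : f ∈ W := ⟨fun y ↦ Subtype.prop _, 1, fun a ha ↦ by rw [hfI ha, one_smul]⟩
  obtain ⟨w, hw, hfw⟩ := LieModule.exists_add_lie_mem (I := I) (W₁ := W₁) (W₀ := W₀) (W := W)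
    (by
      rintro _ ⟨a, ha, rfl⟩
      exact ⟨fun y ↦ hI_lie ha y, fun y hy ↦ habel a ha y hy⟩)
    (by
      rintro g ⟨hg, hg'⟩
      exact ⟨hg, 0, fun a ha ↦ by rw [hg' a ha, zero_smul]⟩)
    (by
      rintro x g ⟨hg, r, hr⟩
      refine ⟨fun y ↦ ?_, fun a ha ↦ ?_⟩
      · rw [LieHom.lie_apply]
        exact sub_mem (I.lie_mem (hg y)) (hg _)
      · rw [LieHom.lie_apply, hr a ha, hr _ (I.lie_mem ha), lie_smul, sub_self])
    (by
      rintro x hx g ⟨hg, r, hr⟩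
      refine ⟨-(r • x), neg_mem (I.smul_mem r hx), LinearMap.ext fun y ↦ ?_⟩
      rw [LieHom.lie_apply, habel x hx _ (hg y), hr _ (hI_lie hx y)]
      simp)
    hfW
  set g := f + w
  have hg (y : L) : g y ∈ I := add_mem (hfW.1 y) (hw.1 y)
  have hgI {a : L} (ha : a ∈ I) : g a = a := by
    rw [LinearMap.add_apply, hfI ha, hw.2 a ha, add_zero]
  have key (x : L) : ∃ a ∈ I, ∀ y, ⁅x, g y⁆ - g ⁅x, y⁆ = ⁅a, y⁆ := by
    obtain ⟨a, ha, hax⟩ := hfw x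
    exact ⟨a, ha, fun y ↦ by rw [← LieHom.lie_apply, ← hax]; rfl⟩
  -- If `I` is central then `ad I = 0`, so `g` is equivariant and its kernel is the complement.
  -- Otherwise the complement is the stabilizer of `g`: for `a` in `I` one has `⁅a, g⁆ = -ad a`,
  -- which absorbs the error and vanishes only for central `a`.
  rcases hcenter with hc | hc
  · have hequiv (x y : L) : g ⁅x, y⁆ = ⁅x, g y⁆ := by
      obtain ⟨a, ha, h⟩ := key x
      have : ⁅a, y⁆ = 0 := by
        rw [← lie_skew, (LieModule.mem_maxTrivSubmodule K L L a).mp (hc ha) y, neg_zero]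
      rw [← sub_eq_zero, ← neg_sub, h, this, neg_zero]
    refine ⟨{ LinearMap.ker g with lie_mem' := fun {x y} _ hy ↦ ?_ }, ?_, ?_⟩
    · change g _ = 0
      have hy : g y = 0 := hy
      rw [hequiv, hy, lie_zero]
    · rw [Submodule.disjoint_def]
      intro x hx hx'
      have hx' : g x = 0 := hx'
      rw [← hgI hx, hx']
    · rw [codisjoint_iff, Submodule.eq_top_iff']
      intro x
      refine Submodule.mem_sup.mpr ⟨g x, hg x, x - g x, ?_, by abel⟩
      change g _ = 0
      rw [map_sub, hgI (hg x), sub_self]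
  · let H : LieSubalgebra K L :=
      { carrier := {x | ⁅x, g⁆ = 0}
        add_mem' ha hb := by
          simp only [Set.mem_ofPred_eq] at *
          rw [add_lie, ha, hb, add_zero]
        zero_mem' := by simp
        smul_mem' c x hx := by
          simp only [Set.mem_ofPred_eq] at *
          rw [smul_lie, hx, smul_zero]
        lie_mem' {x y} hx hy := by
          change ⁅x, g⁆ = 0 at hx
          change ⁅y, g⁆ = 0 at hy
          change ⁅⁅x, y⁆, g⁆ = 0
          rw [lie_lie, hx, hy, lie_zero, lie_zero, sub_zero] }
    have hlie {a : L} (ha : a ∈ I) (y : L) : ⁅a, g⁆ y = -⁅a, y⁆ := by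
      rw [LieHom.lie_apply, habel a ha _ (hg y), hgI (hI_lie ha y), zero_sub]
    refine ⟨H, ?_, ?_⟩
    · rw [Submodule.disjoint_def]
      intro a ha ha'
      have ha' : ⁅a, g⁆ = 0 := ha'
      have : a ∈ I ⊓ LieAlgebra.center K L := by
        refine ⟨ha, (LieModule.mem_maxTrivSubmodule K L L a).mpr fun y ↦ ?_⟩
        rw [← lie_skew, ← hlie ha, ha', LinearMap.zero_apply]
      rwa [hc] at this
    · rw [codisjoint_iff, Submodule.eq_top_iff']
      intro x
      obtain ⟨a, ha, h⟩ := key x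
      refine Submodule.mem_sup.mpr ⟨-a, neg_mem ha, x + a, ?_, by abel⟩
      change ⁅x + a, g⁆ = 0
      ext y
      rw [add_lie, LinearMap.add_apply, hlie ha, LieHom.lie_apply, h, add_neg_cancel,
        LinearMap.zero_apply]

/-- **Levi decomposition**, for a solvable ideal with semisimple quotient. -/
theorem IsSemisimpleQuotient.exists_isCompl [CharZero K] [FiniteDimensional K L]
    {I : LieIdeal K L} [IsSolvable I] (hI : I.IsSemisimpleQuotient) :
    ∃ H : LieSubalgebra K L, IsCompl I.toSubmodule H.toSubmodule := by
  induction hd : finrank K I using Nat.strong_induction_on generalizing L with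
  | _ d ih =>
  subst hd
  by_cases hbot : I = ⊥
  · exact ⟨⊤, by subst hbot; exact isCompl_bot_top⟩
  by_cases h : ∃ I₁ : LieIdeal K L, I₁ ≠ ⊥ ∧ I₁ < I
  swap
  · have h (I₁ : LieIdeal K L) (h₁ : I₁ < I) : I₁ = ⊥ := by
      by_contra h'
      exact h ⟨I₁, h', h₁⟩
    have := hI.hasTrivialRadical
    refine exists_isCompl_of_abelian (fun x hx y hy ↦ ?_) ?_
    · have := LieSubmodule.lie_mem_lie hx hy
      rwa [h _ (lie_self_lt_of_isSolvable hbot)] at this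
    · by_cases hc : I ≤ LieAlgebra.center K L
      · exact .inl hc
      · exact .inr (h _ (inf_le_left.lt_of_ne fun h' ↦ hc (inf_eq_left.mp h')))
  obtain ⟨I₁, h₁bot, h₁⟩ := h
  let q : L →ₗ[K] L ⧸ I₁ := I₁.toSubmodule.mkQ
  have hq_lie (x y : L) : q ⁅x, y⁆ = ⁅q x, q y⁆ := rfl
  have hq {x : L} : q x = 0 ↔ x ∈ I₁ := Submodule.Quotient.mk_eq_zero _
  have hqsurj : Function.Surjective q := I₁.toSubmodule.mkQ_surjective
  let Q : LieIdeal K (L ⧸ I₁) :=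
    { I.toSubmodule.map q with
      lie_mem := by
        rintro x _ ⟨y, hy, rfl⟩
        obtain ⟨x, rfl⟩ := hqsurj x
        exact ⟨⁅x, y⁆, I.lie_mem hy, hq_lie x y⟩ }
  have hqQ {x : L} : q x ∈ Q ↔ x ∈ I := by
    refine ⟨?_, fun hx ↦ ⟨x, hx, rfl⟩⟩
    rintro ⟨y, hy, hxy⟩
    rw [← sub_eq_zero, ← map_sub, hq] at hxy
    simpa using sub_mem hy (h₁.le hxy)
  let p : I →ₗ⁅K⁆ Q :=
    { (q ∘ₗ I.toSubmodule.subtype).codRestrict Q.toSubmodule fun x ↦ hqQ.mpr x.2 with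
      map_lie' := rfl }
  have hp : Function.Surjective p := by
    rintro ⟨_, y, hy, rfl⟩
    exact ⟨⟨y, hy⟩, rfl⟩
  have : IsSolvable Q := hp.lieAlgebra_isSolvable
  have hlt : finrank K Q < finrank K I := by
    refine lt_of_le_of_ne (LinearMap.finrank_le_finrank_of_surjective (f := p.toLinearMap) hp)
      fun heq ↦ h₁bot ((LieSubmodule.eq_bot_iff I₁).mpr fun x hx ↦ ?_)
    have hinj := (LinearMap.injective_iff_surjective_of_finrank_eq_finrank heq.symm
      (f := p.toLinearMap)).mpr hp
    exact congr_arg Subtype.val (hinj (a₁ := ⟨x, h₁.le hx⟩) (a₂ := 0)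
      (Subtype.ext ((hq.mpr hx).trans (map_zero q).symm)))
  have hQ : Q.IsSemisimpleQuotient := by
    intro J hJ hJJ
    let J' : LieIdeal K L :=
      { J.toSubmodule.comap q with
        lie_mem {x y} hy := J.lie_mem (x := q x) hy }
    have hJ' : J' ≤ I := hI J' (fun x hx ↦ hJ (hqQ.mpr hx))
      fun x hx y hy ↦ hqQ.mp (hJJ (q x) hx (q y) hy)
    intro x hx
    obtain ⟨x, rfl⟩ := hqsurj x
    exact hqQ.mpr (hJ' hx)
  obtain ⟨H, hH⟩ := ih _ hlt hQ rfl
  -- The preimage of a complement in `L / I₁` satisfies `I + T = L` and `I ∩ T = I₁`, so a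
  -- complement of `I₁` in `T` is one of `I` in `L`.
  let T : LieSubalgebra K L :=
    { H.toSubmodule.comap q with
      lie_mem' {x y} hx hy := H.lie_mem (x := q x) (y := q y) hx hy }
  have hT {x : L} : x ∈ T ↔ q x ∈ H := Iff.rfl
  have hTI {x : L} (hx : x ∈ T) (hx' : x ∈ I) : x ∈ I₁ :=
    hq.mp (Submodule.disjoint_def.mp hH.disjoint _ (hqQ.mpr hx') (hT.mp hx))
  have hT₁ {x : L} (hx : x ∈ I₁) : x ∈ T := by rw [hT, hq.mpr hx]; exact zero_mem H
  have hsup (x : L) : ∃ i ∈ I, ∃ t ∈ T, x = i + t := by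
    have hx : q x ∈ Q.toSubmodule ⊔ H.toSubmodule := by
      rw [hH.sup_eq_top]; exact Submodule.mem_top
    obtain ⟨_, ⟨i, hi, rfl⟩, t, ht, hit⟩ := Submodule.mem_sup.mp hx
    refine ⟨i, hi, x - i, ?_, by abel⟩
    rw [hT, map_sub, ← hit, add_sub_cancel_left]
    exact ht
  let I' : LieIdeal K T :=
    { I₁.toSubmodule.comap T.toSubmodule.subtype with
      lie_mem {x y} hy := I₁.lie_mem (x := (x : L)) hy }
  let j : I' →ₗ⁅K⁆ I₁ :=
    { (T.toSubmodule.subtype ∘ₗ I'.toSubmodule.subtype).codRestrict I₁.toSubmodule fun x ↦ x.2 with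
      map_lie' := rfl }
  have hj : Function.Injective j := fun x y hxy ↦
    Subtype.ext (Subtype.ext (congr_arg (fun z : I₁ ↦ (z : L)) hxy))
  have : IsSolvable I₁ := le_solvable_ideal_solvable h₁.le inferInstance
  have : IsSolvable I' := hj.lieAlgebra_isSolvable
  have hlt' : finrank K I' < finrank K I :=
    (LinearMap.finrank_le_finrank_of_injective (f := j.toLinearMap) hj).trans_lt
      (Submodule.finrank_lt_finrank_of_lt h₁)
  have hI' : I'.IsSemisimpleQuotient := by
    intro J hJ hJJ
    -- An ideal `J` of `T` abelian modulo `I₁` gives the ideal `I + J` of `L`, abelian modulo `I`.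
    -- Hence `J` lies in `I ∩ T = I₁`.
    let J' : LieIdeal K L :=
      { I.toSubmodule ⊔ J.toSubmodule.map T.toSubmodule.subtype with
        lie_mem := by
          rintro x y hy
          obtain ⟨i, hi, _, ⟨s, hs, rfl⟩, rfl⟩ := Submodule.mem_sup.mp hy
          obtain ⟨i', hi', t, ht, rfl⟩ := hsup x
          refine Submodule.mem_sup.mpr ⟨⁅i' + t, i⁆ + ⁅i', (s : L)⁆, add_mem (I.lie_mem hi)
            (lie_mem_left K L I _ _ hi'), ⁅t, (s : L)⁆, ⟨⁅(⟨t, ht⟩ : T), s⁆, J.lie_mem hs, rfl⟩, ?_⟩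
          simp only [add_lie, lie_add, Submodule.subtype_apply]
          abel }
    have hJ' : J' ≤ I := by
      refine hI J' (fun x hx ↦ Submodule.mem_sup_left hx) fun x hx y hy ↦ ?_
      obtain ⟨i, hi, _, ⟨s, hs, rfl⟩, rfl⟩ := Submodule.mem_sup.mp hx
      obtain ⟨i', hi', _, ⟨t, ht, rfl⟩, rfl⟩ := Submodule.mem_sup.mp hy
      have hst : ⁅(s : L), i' + (t : L)⁆ ∈ I := by
        rw [lie_add]
        exact add_mem (I.lie_mem hi') (h₁.le (hJJ s hs t ht))
      rw [add_lie]
      exact add_mem (lie_mem_left K L I _ _ hi) hst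
    exact fun t ht ↦ hTI t.2 (hJ' (Submodule.mem_sup_right ⟨t, ht, rfl⟩))
  obtain ⟨H', hH'⟩ := ih _ hlt' hI' rfl
  refine ⟨H'.map T.incl, ?_, ?_⟩
  · rw [Submodule.disjoint_def]
    rintro _ hx ⟨t, ht, rfl⟩
    have := Submodule.disjoint_def.mp hH'.disjoint t (hTI t.2 hx) ht
    rw [this, map_zero]
  · rw [codisjoint_iff, Submodule.eq_top_iff']
    intro x
    obtain ⟨i, hi, t, ht, rfl⟩ := hsup x
    have ht' : (⟨t, ht⟩ : T) ∈ I'.toSubmodule ⊔ H'.toSubmodule := by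
      rw [hH'.sup_eq_top]; exact Submodule.mem_top
    obtain ⟨a, ha, b, hb, hab⟩ := Submodule.mem_sup.mp ht'
    have hab : (a : L) + b = t := congr_arg Subtype.val hab
    exact Submodule.mem_sup.mpr ⟨i + a, add_mem hi (h₁.le ha), b, ⟨b, hb, rfl⟩, by
      rw [add_assoc, hab]⟩

end LieIdeal

end

/-! ### Ado's theorem -/

section

open Module LieModule

section

variable {K L : Type*} [Field K] [CharZero K] [IsAlgClosed K] [LieRing L] [LieAlgebra K L]
  [FiniteDimensional K L]

/-- Brackets with elements of a solvable ideal are ad-nilpotent. -/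
lemma LieIdeal.isNilpotent_ad_lie {I : LieIdeal K L} [LieAlgebra.IsSolvable I] (x : L) {y : L}
    (hy : y ∈ I) : IsNilpotent (LieAlgebra.ad K L ⁅x, y⁆) := by
  -- The subalgebra `I + K x` is solvable because its derived algebra lies in `I`, so its brackets
  -- act nilpotently on `L`.
  let B : LieSubalgebra K L :=
    { I.toSubmodule ⊔ K ∙ x with
      lie_mem' := by
        rintro a b ha hb
        obtain ⟨i, hi, _, hc, rfl⟩ := Submodule.mem_sup.mp ha
        obtain ⟨j, hj, _, hd, rfl⟩ := Submodule.mem_sup.mp hb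
        obtain ⟨c, rfl⟩ := Submodule.mem_span_singleton.mp hc
        obtain ⟨d, rfl⟩ := Submodule.mem_span_singleton.mp hd
        refine Submodule.mem_sup_left ?_
        have : ⁅c • x, d • x⁆ = 0 := by simp
        rw [add_lie, lie_add (c • x), this, add_zero]
        exact add_mem (lie_mem_left K L I _ _ hi) (I.lie_mem hj) }
  have hB (a b : B) : (⁅a, b⁆ : L) ∈ I := by
    obtain ⟨i, hi, _, hc, ha⟩ := Submodule.mem_sup.mp a.2
    obtain ⟨j, hj, _, hd, hb⟩ := Submodule.mem_sup.mp b.2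
    obtain ⟨c, rfl⟩ := Submodule.mem_span_singleton.mp hc
    obtain ⟨d, rfl⟩ := Submodule.mem_span_singleton.mp hd
    have : ⁅c • x, d • x⁆ = 0 := by simp
    change ⁅(a : L), (b : L)⁆ ∈ I
    rw [← ha, ← hb, add_lie, lie_add (c • x), this, add_zero]
    exact add_mem (lie_mem_left K L I _ _ hi) (I.lie_mem hj)
  have hD : LieAlgebra.IsSolvable (LieAlgebra.derivedSeries K B 1) := by
    let I' : LieIdeal K B :=
      { I.toSubmodule.comap B.toSubmodule.subtype with
        lie_mem {x y} hy := I.lie_mem (x := (x : L)) hy }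
    have hle : LieAlgebra.derivedSeries K B 1 ≤ I' := by
      rw [LieAlgebra.derivedSeries_def, LieAlgebra.derivedSeriesOfIdeal_succ,
        LieAlgebra.derivedSeriesOfIdeal_zero, LieSubmodule.lieIdeal_oper_eq_span,
        LieSubmodule.lieSpan_le]
      rintro _ ⟨a, b, rfl⟩
      exact hB a b
    let f : LieAlgebra.derivedSeries K B 1 →ₗ⁅K⁆ I :=
      { (B.toSubmodule.subtype ∘ₗ (LieAlgebra.derivedSeries K B 1).toSubmodule.subtype).codRestrict
          I.toSubmodule fun z ↦ hle z.2 with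
        map_lie' := rfl }
    have hf : Function.Injective f := fun a b hab ↦
      Subtype.ext (Subtype.ext (congr_arg (fun z : I ↦ (z : L)) hab))
    exact hf.lieAlgebra_isSolvable
  have : LieAlgebra.IsSolvable B := LieAlgebra.isSolvable_of_derivedSeries_one (K := K)
  exact isNilpotent_toEnd_lie (K := K) (N := B) (V := L)
    ⟨x, Submodule.mem_sup_right (Submodule.mem_span_singleton_self x)⟩
    ⟨y, Submodule.mem_sup_left hy⟩

/-- **Ado's theorem** over an algebraically closed field of characteristic zero. -/
theorem LieAlgebra.exists_injective_representation :
    ∃ (n : ℕ) (ρ : L →ₗ⁅K⁆ End K (Fin n → K)), Function.Injective ρ := by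
  let R := LieAlgebra.radical K L
  obtain ⟨H, hH⟩ := (LieIdeal.isSemisimpleQuotient_radical (K := K) (L := L)).exists_isCompl
  obtain ⟨m, ρ, hρ, hρnil⟩ := IsSolvable.exists_injective_representation (K := K) (L := R)
  obtain ⟨m', Φ, hΦ, -⟩ := LieIdeal.exists_extension ρ (fun x n ↦ hρnil _
    (LieIdeal.isNilpotent_ad_of_isNilpotent_ad (N := R) (LieIdeal.isNilpotent_ad_lie x n.2))) hH
  obtain ⟨k, Ψ, hΨ, -⟩ := exists_prod_representation Φ (LieAlgebra.ad K L)
  refine ⟨k, Ψ, (injective_iff_map_eq_zero Ψ).mpr fun x hx ↦ ?_⟩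
  obtain ⟨h1, h2⟩ := hΨ x hx
  have hxR : x ∈ R := by
    refine center_le_radical K L ((mem_maxTrivSubmodule K L L x).mpr fun y ↦ ?_)
    rw [← lie_skew, ← ad_apply K, h2, LinearMap.zero_apply, neg_zero]
  exact congr_arg Subtype.val ((injective_iff_map_eq_zero ρ).mp hρ ⟨x, hxR⟩ (hΦ ⟨x, hxR⟩ h1))

end

/-! ### Compatibility with the antiholomorphic involution -/

open Matrix in
/-- Any complex matrix representation `f` of `L` yields one of twice the size that intertwines `σ`
with complex conjugation. -/
lemma exists_matrix_representation_conj {L : Type*} [LieRing L]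
    [LieAlgebra ℂ L] {σ : L → L} (hσ : IsAntiholomorphicInvolution σ) {n : ℕ}
    (f : L →ₗ⁅ℂ⁆ Matrix (Fin n) (Fin n) ℂ) (hf : Function.Injective f) :
    ∃ φ : L →ₗ⁅ℂ⁆ Matrix (Fin (2 * n)) (Fin (2 * n)) ℂ, Function.Injective φ ∧
      ∀ X, φ (σ X) = (φ X).map (starRingEnd ℂ) := by
  -- The two conjugate-linear maps compose to a complex linear one.
  let g (X : L) : Matrix (Fin n) (Fin n) ℂ := (f (σ X)).map (starRingEnd ℂ)
  let D (X : L) : Matrix (Fin n ⊕ Fin n) (Fin n ⊕ Fin n) ℂ := fromBlocks (f X) 0 0 (g X)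
  have hg_add (X Y : L) : g (X + Y) = g X + g Y := by
    ext; simp [g, hσ.map_add]
  have hg_smul (c : ℂ) (X : L) : g (c • X) = c • g X := by
    ext; simp [g, hσ.map_smul]
  have hg_lie (X Y : L) : g ⁅X, Y⁆ = g X * g Y - g Y * g X := by
    simp only [g, hσ.map_lie, LieHom.map_lie, LieRing.of_associative_ring_bracket]
    rw [← Matrix.map_mul, ← Matrix.map_mul, ← Matrix.map_sub]
    exact map_sub _
  have hD_add (X Y : L) : D (X + Y) = D X + D Y := by
    simp only [D, fromBlocks_add, map_add, hg_add, add_zero]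
  have hD_smul (c : ℂ) (X : L) : D (c • X) = c • D X := by
    simp only [D, fromBlocks_smul, map_smul, hg_smul, smul_zero]
  have hD_lie (X Y : L) : D ⁅X, Y⁆ = D X * D Y - D Y * D X := by
    simp only [D, fromBlocks_multiply, LieHom.map_lie, LieRing.of_associative_ring_bracket, hg_lie,
      sub_eq_add_neg, fromBlocks_neg, fromBlocks_add]
    simp
  -- Conjugating `S` swaps its two block columns, and conjugating `D X` gives `D (σ X)` with its
  -- diagonal blocks swapped. The swaps cancel in `S * D X * S'`, where `S'` is the inverse of `S`.
  let S : Matrix (Fin n ⊕ Fin n) (Fin n ⊕ Fin n) ℂ :=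
    fromBlocks 1 1 (Complex.I • 1) (-Complex.I • 1)
  let S' : Matrix (Fin n ⊕ Fin n) (Fin n ⊕ Fin n) ℂ :=
    (2⁻¹ : ℂ) • fromBlocks 1 (-Complex.I • 1) 1 (Complex.I • 1)
  have hS : S' * S = 1 := by
    simp only [S, S', smul_mul_assoc, fromBlocks_multiply, fromBlocks_smul]
    rw [← fromBlocks_one]
    congr 1 <;> ext i j <;> simp [Matrix.one_apply] <;> split_ifs <;> simp <;> norm_num
  let e : Fin n ⊕ Fin n ≃ Fin (2 * n) := finSumFinEquiv.trans (finCongr (two_mul n).symm)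
  let E := reindexAlgEquiv ℂ ℂ e
  let φ : L →ₗ⁅ℂ⁆ Matrix (Fin (2 * n)) (Fin (2 * n)) ℂ :=
    { toFun X := E (S * D X * S')
      map_add' X Y := by rw [hD_add, mul_add, add_mul, map_add E]
      map_smul' c X := by
        rw [hD_smul, Matrix.mul_smul S c (D X), Matrix.smul_mul c (S * D X) S', map_smul E,
          RingHom.id_apply]
      map_lie' {X Y} := by
        have hmul (A B : Matrix (Fin n ⊕ Fin n) (Fin n ⊕ Fin n) ℂ) :
            S * A * S' * (S * B * S') = S * (A * B) * S' := by
          calc _ = S * A * (S' * S) * B * S' := by simp only [mul_assoc]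
            _ = _ := by rw [hS, mul_one, mul_assoc S]
        rw [LieRing.of_associative_ring_bracket, ← map_mul, ← map_mul, ← map_sub, hmul, hmul, hD_lie,
          mul_sub, sub_mul] }
  have hφ (X : L) : φ X = E (S * D X * S') := rfl
  refine ⟨φ, fun X Y h ↦ hf ?_, fun X ↦ ?_⟩
  · have h1 : S * D X * S' = S * D Y * S' := E.injective h
    have hcancel (A : Matrix (Fin n ⊕ Fin n) (Fin n ⊕ Fin n) ℂ) : S' * (S * A * S') * S = A := by
      calc _ = (S' * S) * A * (S' * S) := by simp only [mul_assoc]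
        _ = _ := by rw [hS, one_mul, mul_one]
    have h2 : D X = D Y := by rw [← hcancel (D X), h1, hcancel]
    exact (fromBlocks_inj.mp h2).1
  · have hgσ : g (σ X) = (f X).map (starRingEnd ℂ) := by simp only [g, hσ.involutive]
    have hfσ : f (σ X) = (g X).map (starRingEnd ℂ) := by ext; simp [g]
    have key : S * D (σ X) * S' = (S * D X * S').map (starRingEnd ℂ) := by
      simp only [S, S', D, mul_smul_comm, fromBlocks_multiply, fromBlocks_smul, fromBlocks_map,
        hgσ, hfσ]
      have h2 : (starRingEnd ℂ) 2 = 2 := map_ofNat _ 2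
      congr 1 <;> ext i j <;> simp [h2] <;> ring
    rw [hφ, hφ, key]
    rfl

end

theorem lemmaA1 {L : Type*} [LieRing L] [LieAlgebra ℂ L] [FiniteDimensional ℂ L]
    (σ : L → L) (hσ : IsAntiholomorphicInvolution σ) :
    ∃ m : ℕ, 0 < m ∧
      ∃ φ : L →ₗ⁅ℂ⁆ Matrix (Fin (2 * m)) (Fin (2 * m)) ℂ,
        Function.Injective φ ∧
          ∀ X : L, φ (σ X) = (φ X).map (starRingEnd ℂ) := by
  obtain ⟨n, ρ, hρ⟩ := LieAlgebra.exists_injective_representation (K := ℂ) (L := L)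
  let f : L →ₗ⁅ℂ⁆ Matrix (Fin n) (Fin n) ℂ :=
    (AlgHom.toLieHom (algEquivMatrix' (R := ℂ) (n := Fin n)).toAlgHom).comp ρ
  have hf : Function.Injective f := algEquivMatrix'.injective.comp hρ
  rcases n.eq_zero_or_pos with rfl | hn
  · have : Subsingleton L := hf.subsingleton
    -- A representation of size zero forces `L = 0`, and any positive `m` serves.
    exact ⟨1, one_pos, 0, Function.injective_of_subsingleton _, fun X ↦ by ext; simp⟩
  · exact ⟨n, hn, exists_matrix_representation_conj hσ f hf⟩
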